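/- **Setting.** Let $\phi$ be the ReLU. A network $\theta=(A_1,\dots,A_d)$, $d\ge 2$, $A_i\in\mathbb R^{h_i\times h_{i-1}}$, has preactivations $x^0=x$, $x^1=A_1x$, $x^i=A_i\phi(x^{i-1})$ for $2\le i\le d$, and output $f_\theta(x)=x^d$. Put $h_{\min}=\min_{1\le i\le d-1}h_i$. Let $S$ be a finite non-empty set of pairs $(x,y)\in\mathbb R^{h_0}\times\mathbb R^{h_d}$, let $l(y,\hat y)$ be $\beta$-Lipschitz in $\hat y$, and let $L(\theta)=\frac1{|S|}\sum_{(x,y)\in S}l(y,f_\theta(x))$. $\|\cdot\|$ is the $\ell_2$ norm of vectors and the operator norm of matrices, $\|\cdot\|_F$ the Frobenius norm, and $[A]_j$ the $j$-th column of $A$. Dropout with probability $p$ replaces $A_i$ ($2\le i\le d$) by $\hat A_i$ with columns $[\hat A_i]_j=\delta_{ij}[A_i]_j$, where all $\delta_{ij}$ are independent, equal to $0$ with probability $p$ and to $\frac1{1-p}$ with probability $1-p$. Let $\theta^i=(A_1,\hat A_2,\dots,\hat A_i,A_{i+1},\dots,A_d)$ and $\theta_1=\theta^d$. For $t\in[0,1]$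 let $\hat x^i_i(t)$ and $\hat x^i_{i-1}(t)$ be the preactivations at layer $i$ of the networks $t\theta+(1-t)\theta^i$ and $t\theta+(1-t)\theta^{i-1}$ on input $x$. Let $M^{i,j}$ be the map with $x^j=M^{i,j}(x^i)$ and $J^{i,j}_{x^i}$ its Jacobian at $x^i$, computed by the chain rule with $\phi'(0)=0$. Write $\min_x,\max_x$ for extrema over the inputs of $S$, and put $$\mu_i=\min_{x}\frac{\|A_i\phi(x^{i-1})\|}{\|A_i\|_F\|\phi(x^{i-1})\|},\quad \mu_{i\to}=\min_{i\le j\le d}\min_{x}\frac{\|J^{i,j}_{x^i}x^i\|}{\|J^{i,j}_{x^i}\|\|x^i\|},\quad c=\max_{x,\,1\le i\le d-1}\frac{\|x^i\|}{\|\phi(x^i)\|},$$ $$\epsilon=\frac{\beta\,c\,d^{3/2}\max_{x}\|f_\theta(x)\|}{h_{\min}^{1/2}\,\min_{2\le i\le d}\mu_i\mu_{i\to}},\qquad \Lambda=\log\Big(3+|S|+d+\max_{x}\|x\|+\frac{\beta}{\epsilon}+\sum_{i=1}^d(h_i+\|A_i\|)\Big).$$ **Statement.** There is a universal $k\in\mathbb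 N$ such that for every $K>0$ there is a constant $C>0$, depending only on $K$, with the following property for all $d,h_i,l,\beta,S,\theta,p$. Assume: 1. ($\theta$ is $\epsilon$-noise stable.) $f_\theta(x)\ne0$ for every input $x$ of $S$ (equivalently, the quantities above are well defined); $h_{\min}\ge C\Lambda^k$; and for some $\rho\ge3d$, with probability at least $1/2$ over the dropout, the following hold simultaneously for all inputs $x$ of $S$ and all $0\le t\le1$: - for all $2\le i\le j\le d$ and both $v=\hat x^i_i(t)$ and $v=\hat x^i_{i-1}(t)$: $\ \|M^{i,j}(v)-J^{i,j}_{x^i}v\|\le\frac{\|v-x^i\|\|x^j\|}{\rho\|x^i\|}$; - for all $1\le i\le d-1$: $\ \|\phi(\hat x^i_i(t))\|_\infty\le\frac{K}{\sqrt{h_i}}\|\phi(\hat x^i_i(t))\|$. 2. $C\Lambda^k/h_{\min}<p\le\frac34$. 3. $\|[A_i]_j\|\le K\sqrt p\,\|A_i\|_F$ for all $2\le i\le d$, $1\le j\le h_{i-1}$. 4. $\sqrt p\,\epsilon\,\Lambda^k\le K\beta\max_{x}\|f_\theta(x)\|$. Then, with probability at least $1/4$ over the dropout, for every $0\le t\le1$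 the network $\theta_t=\theta+t(\theta_1-\theta)$ satisfies $$L(\theta_t)\le L(\theta)+C\sqrt p\,\epsilon\,\Lambda^k .$$ In particular, if $p=\frac34$, then $\theta$ is dropout stable in the following sense: one can keep at most $\lfloor h_i/2\rfloor$ units in each hidden layer $i$, multiply their outputs by a common factor, set the outputs of all other hidden units to zero, and obtain a network of loss at most $L(\theta)+C\sqrt p\,\epsilon\,\Lambda^k$. -/

import Mathlib

open MeasureTheory
open scoped Matrix.Norms.L2Operator

noncomputable section

namespace ReluNet

/-- Euclidean space `ℝⁿ` with the `ℓ₂` norm. -/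
abbrev Vec (n : ℕ) := EuclideanSpace ℝ (Fin n)

/-- Parameters of a fully connected network with layer widths `h 0` (input), `h 1`, `h 2`, ….
The matrix `θ i` has size `h (i+1) × h i`; it is the weight matrix `A_{i+1}` of layer `i+1`.
A network with `d` layers only uses `θ 0, …, θ (d-1)`. -/
abbrev Params (h : ℕ → ℕ) := (i : ℕ) → Matrix (Fin (h (i + 1))) (Fin (h i)) ℝ

/-- The ReLU activation, coordinatewise. -/
def relu {n : ℕ} (v : Vec n) : Vec n := WithLp.toLp 2 fun k => max (v k) 0

/-- What is fed into the weight matrix of layer `i+1`: the input itself for `i = 0`, and the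
ReLU of the preactivation of layer `i` for `i ≥ 1`. -/
def act {h : ℕ → ℕ} : (i : ℕ) → Vec (h i) → Vec (h i)
  | 0, v => v
  | _ + 1, v => relu v

/-- Coordinatewise derivative of `act i` at `v`, with the convention `ReLU'(0) = 0`. -/
def actDeriv {h : ℕ → ℕ} : (i : ℕ) → Vec (h i) → Fin (h i) → ℝ
  | 0, _ => fun _ => 1
  | _ + 1, v => fun k => if 0 < v k then 1 else 0

/-- The map from the preactivation of layer `i` to the preactivation of layer `i+1`. -/
def step {h : ℕ → ℕ} (θ : Params h) (i : ℕ) (v : Vec (h i)) : Vec (h (i + 1)) :=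
  Matrix.toEuclideanLin (θ i) (act i v)

/-- The vector `x^i` before activation at layer `i` on input `x` (with `x^0 = x`). -/
def preact {h : ℕ → ℕ} (θ : Params h) (x : Vec (h 0)) : (i : ℕ) → Vec (h i)
  | 0 => x
  | i + 1 => step θ i (preact θ x i)

/-- The function `f_θ` computed by the network with `d` layers. -/
def output {h : ℕ → ℕ} (d : ℕ) (θ : Params h) (x : Vec (h 0)) : Vec (h d) := preact θ x d

/-- The operator `M^{i,i+k}` composing the layers after `i` up to `i+k`. -/
def layerMap {h : ℕ → ℕ} (θ : Params h) (i : ℕ) : (k : ℕ) → Vec (h i) → Vec (h (i + k))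
  | 0, v => v
  | k + 1, v => step θ (i + k) (layerMap θ i k v)

/-- The Jacobian of `M^{i,i+k}` at `v`, by the chain rule. -/
def jacobian {h : ℕ → ℕ} (θ : Params h) (i : ℕ) :
    (k : ℕ) → Vec (h i) → Matrix (Fin (h (i + k))) (Fin (h i)) ℝ
  | 0, _ => 1
  | k + 1, v =>
      θ (i + k) * Matrix.diagonal (actDeriv (i + k) (layerMap θ i k v)) * jacobian θ i k v

/-- The Frobenius norm. (The notation `‖A‖` for a matrix is the operator norm for `ℓ₂`.) -/
def frob {m n : ℕ} (A : Matrix (Fin m) (Fin n) ℝ) : ℝ := Real.sqrt (∑ r, ∑ j, A r j ^ 2)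

/-- The `j`-th column of a matrix, as a Euclidean vector. -/
def column {m n : ℕ} (A : Matrix (Fin m) (Fin n) ℝ) (j : Fin n) : Vec m :=
  WithLp.toLp 2 fun r => A r j

/-- Multiply the `j`-th column of `A` by `s j`. -/
def scaleColumns {m n : ℕ} (A : Matrix (Fin m) (Fin n) ℝ) (s : Fin n → ℝ) :
    Matrix (Fin m) (Fin n) ℝ :=
  Matrix.of fun r j => s j * A r j

/-- The training set: finitely many pairs (input, label). -/
abbrev Sample (d : ℕ) (h : ℕ → ℕ) := Finset (Vec (h 0) × Vec (h d))

/-- The empirical loss `L(θ) = (1/|S|) ∑_{(x,y) ∈ S} l(y, f_θ(x))`. -/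
def loss {d : ℕ} {h : ℕ → ℕ} (l : Vec (h d) → Vec (h d) → ℝ) (S : Sample d h)
    (θ : Params h) : ℝ :=
  (1 / (S.card : ℝ)) * ∑ z ∈ S, l z.2 (output d θ z.1)

/-! ### Dropout -/

/-- Outcomes of the dropout of layers `2, …, d`: for every hidden layer `i+1` (`1 ≤ i+1 ≤ d-1`)
and every unit `j` of it, `true` if column `j` of `A_{i+2}` is kept, `false` if it is dropped. -/
abbrev Mask (d : ℕ) (h : ℕ → ℕ) := (i : Fin (d - 1)) → Fin (h (i + 1)) → Bool

/-- Law of one bit: dropped with probability `p`, kept with probability `1 - p`. -/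
def bitLaw (p : ℝ) : Measure Bool :=
  ENNReal.ofReal p • Measure.dirac false + ENNReal.ofReal (1 - p) • Measure.dirac true

/-- Law of the dropout outcome: all bits are independent. -/
def dropoutLaw (d : ℕ) (h : ℕ → ℕ) (p : ℝ) : Measure (Mask d h) :=
  Measure.pi fun i => Measure.pi fun _ : Fin (h (i + 1)) => bitLaw p

/-- The multiplier of a column: `0` if dropped and `1/(1-p)` if kept. -/
def multiplier (p : ℝ) (b : Bool) : ℝ := if b then 1 / (1 - p) else 0

/-- The parameters `θ^n = (A₁, Â₂, …, Â_n, A_{n+1}, …, A_d)` obtained from `θ` by dropping out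
the columns of the weight matrices of layers `2, …, n` (`n ≤ d`). Recall `θ (i+1) = A_{i+2}`. -/
def dropUpTo {d : ℕ} {h : ℕ → ℕ} (p : ℝ) (w : Mask d h) (θ : Params h) (n : ℕ) : Params h
  | 0 => θ 0
  | i + 1 =>
      if hi : i < d - 1 then
        if i + 2 ≤ n then scaleColumns (θ (i + 1)) fun j => multiplier p (w ⟨i, hi⟩ j)
        else θ (i + 1)
      else θ (i + 1)

/-- The point `θ + t (θ' - θ)` of the segment from `θ` to `θ'`. -/
def onSegment {h : ℕ → ℕ} (θ θ' : Params h) (t : ℝ) : Params h := θ + t • (θ' - θ)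

/-- Dropout stability: one can keep at most half of the units in each hidden layer, multiply
their outputs by a common factor `r`, set the outputs of all other hidden units to zero
(that is, scale the columns of the next weight matrix accordingly), and thereby increase the
loss by at most `η`. -/
def IsDropoutStable {d : ℕ} {h : ℕ → ℕ} (l : Vec (h d) → Vec (h d) → ℝ) (S : Sample d h)
    (θ : Params h) (η : ℝ) : Prop :=
  ∃ (r : ℝ) (U : (i : ℕ) → Finset (Fin (h i))) (θ' : Params h),
    (∀ i, 1 ≤ i → i < d → (U i).card ≤ h i / 2) ∧
    θ' 0 = θ 0 ∧
    (∀ i, 1 ≤ i → i < d → θ' i = scaleColumns (θ i) fun j => if j ∈ U i then r else 0) ∧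
    loss l S θ' ≤ loss l S θ + η

/-! ### Noise stability quantities -/

/-- The minimum width `h_min` of the hidden layers `1, …, d-1`. -/
def minWidth (d : ℕ) (h : ℕ → ℕ) : ℕ := ⨅ i : Fin (d - 1), h (i + 1)

/-- The layer cushion `μ_{i+1}` of layer `i+1`. -/
def layerCushion {d : ℕ} {h : ℕ → ℕ} (S : Sample d h) (θ : Params h) (i : ℕ) : ℝ :=
  ⨅ z : S, ‖Matrix.toEuclideanLin (θ i) (act i (preact θ z.1.1 i))‖ /
    (frob (θ i) * ‖act i (preact θ z.1.1 i)‖)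

/-- The interlayer cushion `μ_{i,i+k}`. -/
def interlayerCushion {d : ℕ} {h : ℕ → ℕ} (S : Sample d h) (θ : Params h) (i k : ℕ) : ℝ :=
  ⨅ z : S, ‖Matrix.toEuclideanLin (jacobian θ i k (preact θ z.1.1 i)) (preact θ z.1.1 i)‖ /
    (‖jacobian θ i k (preact θ z.1.1 i)‖ * ‖preact θ z.1.1 i‖)

/-- The minimal interlayer cushion `min_{i ≤ j ≤ d} μ_{i,j}` of layer `i`. -/
def minInterlayerCushion {d : ℕ} {h : ℕ → ℕ} (S : Sample d h) (θ : Params h) (i : ℕ) : ℝ :=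
  ⨅ k : Fin (d - i + 1), interlayerCushion S θ i k

/-- `min_{2 ≤ i ≤ d}` of (layer cushion of `i`) · (minimal interlayer cushion of `i`). -/
def minCushion {d : ℕ} {h : ℕ → ℕ} (S : Sample d h) (θ : Params h) : ℝ :=
  ⨅ i : Fin (d - 1), layerCushion S θ (i + 1) * minInterlayerCushion S θ (i + 2)

/-- The activation contraction `c = max ‖x^i‖ / ‖φ(x^i)‖` over `x ∈ S`, `1 ≤ i ≤ d-1`. -/
def activationContraction {d : ℕ} {h : ℕ → ℕ} (S : Sample d h) (θ : Params h) : ℝ :=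
  ⨆ z : S, ⨆ i : Fin (d - 1), ‖preact θ z.1.1 (i + 1)‖ / ‖relu (preact θ z.1.1 (i + 1))‖

/-- `max_{x ∈ S} ‖x‖`. -/
def maxInput {d : ℕ} {h : ℕ → ℕ} (S : Sample d h) : ℝ := ⨆ z : S, ‖z.1.1‖

/-- `max_{x ∈ S} ‖f_θ(x)‖`. -/
def maxOutput {d : ℕ} {h : ℕ → ℕ} (S : Sample d h) (θ : Params h) : ℝ :=
  ⨆ z : S, ‖output d θ z.1.1‖

/-- The two interlayer smoothness inequalities with constant `ρ`, for the dropout outcome `w`,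
for all `2 ≤ i ≤ j = i + k ≤ d`, all inputs, and all points `t` of the segments. The vectors
`x̂^i_i(t)` and `x̂^i_{i-1}(t)` are the preactivations at layer `i` of the networks on the
segments between `θ` and `θ^i`, and between `θ` and `θ^{i-1}`. -/
def SmoothFor {d : ℕ} {h : ℕ → ℕ} (S : Sample d h) (θ : Params h) (p ρ : ℝ)
    (w : Mask d h) : Prop :=
  ∀ z ∈ S, ∀ i k : ℕ, 2 ≤ i → i + k ≤ d → ∀ n : ℕ, n = i ∨ n + 1 = i →
    ∀ t ∈ Set.Icc (0 : ℝ) 1,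
      ‖layerMap θ i k (preact (onSegment θ (dropUpTo p w θ n) t) z.1 i) -
          Matrix.toEuclideanLin (jacobian θ i k (preact θ z.1 i))
            (preact (onSegment θ (dropUpTo p w θ n) t) z.1 i)‖ ≤
        ‖preact (onSegment θ (dropUpTo p w θ n) t) z.1 i - preact θ z.1 i‖ *
            ‖preact θ z.1 (i + k)‖ /
          (ρ * ‖preact θ z.1 i‖)

/-- For the dropout outcome `w`, the activations `φ(x̂^i_i(t))`, `1 ≤ i ≤ d-1`, are spread out:
`‖φ(x̂^i_i(t))‖_∞ ≤ (K / √h_i) ‖φ(x̂^i_i(t))‖`. -/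
def SpreadFor {d : ℕ} {h : ℕ → ℕ} (S : Sample d h) (θ : Params h) (p K : ℝ)
    (w : Mask d h) : Prop :=
  ∀ z ∈ S, ∀ i : ℕ, 1 ≤ i → i < d → ∀ t ∈ Set.Icc (0 : ℝ) 1, ∀ j : Fin (h i),
    |relu (preact (onSegment θ (dropUpTo p w θ i) t) z.1 i) j| ≤
      K / Real.sqrt (h i) * ‖relu (preact (onSegment θ (dropUpTo p w θ i) t) z.1 i)‖

/-- The noise stability parameter
`ε = β c d^{3/2} max_x ‖f_θ(x)‖ / (h_min^{1/2} min_{2 ≤ i ≤ d} (μ_i μ_{i→}))`. -/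
def noiseParameter {d : ℕ} {h : ℕ → ℕ} (S : Sample d h) (θ : Params h) (β : ℝ) : ℝ :=
  β * activationContraction S θ * (d : ℝ) ^ (3 / 2 : ℝ) * maxOutput S θ /
    (Real.sqrt (minWidth d h) * minCushion S θ)

/-- `θ` is `ε`-noise stable, for dropout probability `p`, hidden constant `K` in the spreading
condition, and required minimum width `H`.

The first field says that `ε` is well defined: given it, no denominator in the definition of
the cushions, of the activation contraction and of `ε` vanishes, and conversely.
The last field says that the interlayer smoothness `ρ` is at least `3d`. The activations
in the spreading condition are random too; that condition is only asked for together with the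
smoothness inequalities, on an event of probability at least `1/2`. -/
structure IsNoiseStable {d : ℕ} {h : ℕ → ℕ} (S : Sample d h) (θ : Params h)
    (β p K H ε : ℝ) : Prop where
  output_ne_zero : ∀ z ∈ S, output d θ z.1 ≠ 0
  eps_eq : ε = noiseParameter S θ β
  width : H ≤ (minWidth d h : ℝ)
  smooth : ∃ ρ : ℝ, 3 * (d : ℝ) ≤ ρ ∧
    1 / 2 ≤ (dropoutLaw d h p).real {w | SmoothFor S θ p ρ w ∧ SpreadFor S θ p K w}

/-- The logarithm whose powers are the poly-logarithmic factors: the factors inside are `|S|`,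
`d`, `max ‖x‖`, `β/ε`, the widths `h_i`, and the norms `‖A_i‖`, `1 ≤ i ≤ d`. -/
def logFactor {d : ℕ} {h : ℕ → ℕ} (S : Sample d h) (θ : Params h) (β ε : ℝ) : ℝ :=
  Real.log (3 + (S.card : ℝ) + (d : ℝ) + maxInput S + β / ε +
    ∑ i ∈ Finset.range d, ((h (i + 1) : ℝ) + ‖θ i‖))

end ReluNet

end

/-! Dropping out one layer perturbs its preactivation by a sum, over the units feeding it, of (δ -
1) times activation times column. Given the masks of the earlier layers, this is a sum of
independent centred vectors, each small because activations and columns are spread out. Measured in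
units of ‖A‖_F ‖φ‖ times a scale of order √(p / h_min), its norm therefore has a bounded exponential
moment (`sum_exp_noise_le`). The activations entering a layer depend only on earlier masks, so these
moments multiply (`sum_prod_mul_prod_le`), and the total normalized noise is at most 12dΛ up to
exponentially small probability. The spread condition is assumed only on an event that involves all
masks, and conditioning on it would destroy independence. `layerNoise` is cut off instead: its
moment bound is unconditional, and on the good event the cut-off is idle (`norm_noise_le`).

The propagation is deterministic. The layer cushion and the contraction c turn the noise of a layer
into a relative error α of its preactivation. The interlayer cushion controls how the Jacobian
amplifies it, and ρ ≥ 3d makes linearization cost only a factor 1 + 1/d per layer. A relative error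
q thus becomes q(1 + 2α + 1/d) + 2α (`norm_preact_sub_le_step`), which accumulates to at most 2A
exp(2A + 1), with A the sum of the α's (`norm_preact_sub_le`). Here A is at most a multiple of √p ε
Λ / (β max ‖f‖), which assumption 4 bounds, so the exponential is a constant and the Lipschitz loss
gives the estimate with k = 1.

Uniformity in t comes from a union bound over the inputs and a grid of exp(O(dΛ)) points, failing
with probability at most 1/4 against the assumed 1/2. A crude Lipschitz bound fills the gaps
(`mul_norm_output_sub_le`). For p = 3/4, a Chernoff bound (`dropoutLaw_real_kept_le`) shows that
some mask with small loss keeps at most half of every layer. -/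

namespace ReluNet

/-! ### Expectations under finite product laws -/

/-- Averaging out one coordinate of a product law does not change an expectation. -/
theorem sum_prod_mul_update {ι : Type*} [Fintype ι] [DecidableEq ι] {α : ι → Type*}
    [∀ i, Fintype (α i)] (q : ∀ i, α i → ℝ) (hq : ∀ i, ∑ a, q i a = 1)
    (f : (∀ i, α i) → ℝ) (i : ι) :
    ∑ w, (∏ k, q k (w k)) * ∑ a, q i a * f (Function.update w i a) =
      ∑ w, (∏ k, q k (w k)) * f w := by
  have key : ∀ (w : ∀ i, α i) (a : α i),
      (∏ k, q k (w k)) * q i a = (∏ k, q k (Function.update w i a k)) * q i (w i) := by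
    intro w a
    rw [← Finset.mul_prod_erase _ _ (Finset.mem_univ i),
      ← Finset.mul_prod_erase Finset.univ (fun k => q k (Function.update w i a k))
        (Finset.mem_univ i)]
    have : ∏ k ∈ Finset.univ.erase i, q k (Function.update w i a k) =
        ∏ k ∈ Finset.univ.erase i, q k (w k) :=
      Finset.prod_congr rfl fun k hk => by
        rw [Function.update_of_ne (Finset.ne_of_mem_erase hk)]
    rw [this, Function.update_self]
    ring
  -- Swapping coordinate i with an independent copy is an involution preserving the joint weight, by
  -- `key`.
  let e : ((∀ i, α i) × α i) → ((∀ i, α i) × α i) := fun x =>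
    (Function.update x.1 i x.2, x.1 i)
  have he : Function.Involutive e := by
    rintro ⟨w, a⟩
    simp [e]
  calc ∑ w, (∏ k, q k (w k)) * ∑ a, q i a * f (Function.update w i a)
      = ∑ x : (∀ i, α i) × α i,
          (∏ k, q k (x.1 k)) * q i x.2 * f (Function.update x.1 i x.2) := by
        rw [Fintype.sum_prod_type]
        refine Finset.sum_congr rfl fun w _ => ?_
        rw [Finset.mul_sum]
        exact Finset.sum_congr rfl fun a _ => by ring
    _ = ∑ x : (∀ i, α i) × α i, (∏ k, q k (x.1 k)) * q i x.2 * f x.1 := by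
        refine Fintype.sum_equiv he.toPerm _ _ fun x => ?_
        rw [key]
        rfl
    _ = _ := by
        rw [Fintype.sum_prod_type]
        refine Finset.sum_congr rfl fun w _ => ?_
        dsimp only
        rw [← Finset.sum_mul, ← Finset.mul_sum, hq, mul_one]

theorem sum_prod_eq_one {ι : Type*} [Fintype ι] [DecidableEq ι] {α : ι → Type*}
    [∀ i, Fintype (α i)] (q : ∀ i, α i → ℝ) (hq : ∀ i, ∑ a, q i a = 1) :
    ∑ w : (∀ i, α i), ∏ k, q k (w k) = 1 := by
  classical
  rw [← Fintype.piFinset_univ, ← Finset.prod_univ_sum]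
  simp [hq]

/-- A product of nonnegative adapted factors, each of conditional expectation at most `B`, has
expectation at most `B ^ n`. -/
theorem sum_prod_mul_prod_le {n : ℕ} {α : Fin n → Type*} [∀ i, Fintype (α i)]
    (q : ∀ i, α i → ℝ) (hq0 : ∀ i a, 0 ≤ q i a) (hq : ∀ i, ∑ a, q i a = 1)
    (g : Fin n → (∀ i, α i) → ℝ) (hg : ∀ i w, 0 ≤ g i w)
    (hadapted : ∀ i j, i < j → ∀ w a, g i (Function.update w j a) = g i w)
    {B : ℝ} (hB : ∀ i w, ∑ a, q i a * g i (Function.update w i a) ≤ B) (hB0 : 0 ≤ B) :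
    ∑ w, (∏ k, q k (w k)) * ∏ i, g i w ≤ B ^ n := by
  have main : ∀ m ≤ n, ∑ w, (∏ k, q k (w k)) *
      ∏ i ∈ Finset.univ.filter (fun i : Fin n => i.val < m), g i w ≤ B ^ m := by
    intro m
    induction m with
    | zero =>
      intro _
      have : ∑ w : (∀ i, α i), (∏ k, q k (w k)) = 1 := sum_prod_eq_one q hq
      simp [this]
    | succ m ih =>
      intro hm
      have ih := ih (by omega)
      let i : Fin n := ⟨m, hm⟩
      have hset : Finset.univ.filter (fun j : Fin n => j.val < m + 1) =
          insert i (Finset.univ.filter (fun j : Fin n => j.val < m)) := by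
        ext j
        simp only [Finset.mem_filter, Finset.mem_univ, true_and, Finset.mem_insert, Fin.ext_iff, i]
        omega
      have hni : i ∉ Finset.univ.filter (fun j : Fin n => j.val < m) := by simp [i]
      -- Resampling coordinate m alone leaves the earlier factors fixed and replaces the newest one
      -- by its conditional expectation.
      rw [← sum_prod_mul_update q hq _ i]
      calc _ ≤ ∑ w, (∏ k, q k (w k)) *
            ((∏ j ∈ Finset.univ.filter (fun j : Fin n => j.val < m), g j w) * B) := by
            refine Finset.sum_le_sum fun w _ => ?_
            refine mul_le_mul_of_nonneg_left ?_ (Finset.prod_nonneg fun k _ => hq0 _ _)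
            calc _ = (∏ j ∈ Finset.univ.filter (fun j : Fin n => j.val < m), g j w) *
                  ∑ a, q i a * g i (Function.update w i a) := by
                  rw [Finset.mul_sum]
                  refine Finset.sum_congr rfl fun a _ => ?_
                  rw [hset, Finset.prod_insert hni]
                  have : ∏ j ∈ Finset.univ.filter (fun j : Fin n => j.val < m),
                      g j (Function.update w i a) =
                      ∏ j ∈ Finset.univ.filter (fun j : Fin n => j.val < m), g j w := by
                    refine Finset.prod_congr rfl fun j hj => hadapted j i ?_ w a
                    simpa [i, Fin.lt_def] using hj
                  rw [this]
                  ring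
              _ ≤ _ := mul_le_mul_of_nonneg_left (hB i w) (Finset.prod_nonneg fun j _ => hg j w)
        _ = (∑ w, (∏ k, q k (w k)) *
              ∏ j ∈ Finset.univ.filter (fun j : Fin n => j.val < m), g j w) * B := by
            rw [Finset.sum_mul]
            exact Finset.sum_congr rfl fun w _ => by ring
        _ ≤ B ^ m * B := mul_le_mul_of_nonneg_right ih hB0
        _ = B ^ (m + 1) := (pow_succ _ _).symm
  have := main n le_rfl
  simpa using this

/-! ### Exponential moments of sums of centred dropout vectors -/

/-- The mass function of `bitLaw p`. -/
noncomputable def bitWeight (p : ℝ) (b : Bool) : ℝ := if b then 1 - p else p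

theorem bitWeight_nonneg {p : ℝ} (hp0 : 0 ≤ p) (hp1 : p ≤ 1) (b : Bool) : 0 ≤ bitWeight p b := by
  cases b <;> simp [bitWeight] <;> linarith

theorem sum_bitWeight (p : ℝ) : ∑ b, bitWeight p b = 1 := by simp [bitWeight]

theorem abs_multiplier_sub_one_le {p : ℝ} (hp0 : 0 < p) (hp1 : p ≤ 3 / 4) (b : Bool) :
    |multiplier p b - 1| ≤ 3 := by
  have hp' : 0 < 1 - p := by linarith
  cases b
  · simp [multiplier]
  · simp only [multiplier, if_true]
    have : 1 / (1 - p) ≤ 4 := by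
      rw [div_le_iff₀ hp']; linarith
    have : 1 ≤ 1 / (1 - p) := by
      rw [le_div_iff₀ hp']; linarith
    rw [abs_le]; constructor <;> linarith

section ExpMoment

variable {E : Type*} [NormedAddCommGroup E] [InnerProductSpace ℝ E]

/-- The function √(1 + ‖y‖²) is a smooth substitute for the norm. Its first-order term is linear in
w, so it averages out for centred w, and only a multiple of ‖w‖² is left. -/
theorem exp_sqrt_one_add_norm_sq_add_le (y w : E) (hw : ‖w‖ ≤ 2 / 3) :
    Real.exp √(1 + ‖y + w‖ ^ 2) ≤
      Real.exp √(1 + ‖y‖ ^ 2) * (1 + inner ℝ y w / √(1 + ‖y‖ ^ 2) + 3 * ‖w‖ ^ 2) := by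
  set R := √(1 + ‖y‖ ^ 2) with hR
  have hR2 : R ^ 2 = 1 + ‖y‖ ^ 2 := Real.sq_sqrt (by positivity)
  have hR1 : 1 ≤ R := by
    rw [hR]
    exact Real.one_le_sqrt.2 (by nlinarith [sq_nonneg ‖y‖])
  have hyR : ‖y‖ ≤ R := by
    rw [hR]
    exact Real.le_sqrt_of_sq_le (by linarith)
  have hR0 : 0 < R := by linarith
  set a := inner ℝ y w / R with ha
  have haR : inner ℝ y w = a * R := by rw [ha]; field_simp
  have habs : |a| ≤ ‖w‖ := by
    rw [ha, abs_div, abs_of_pos hR0, div_le_iff₀ hR0]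
    calc |inner ℝ y w| ≤ ‖y‖ * ‖w‖ := abs_real_inner_le_norm y w
      _ ≤ R * ‖w‖ := by gcongr
      _ = ‖w‖ * R := mul_comm _ _
  have hw0 := norm_nonneg w
  obtain ⟨ha1, ha2⟩ := abs_le.1 habs
  have hsqrt : √(1 + ‖y + w‖ ^ 2) ≤ R + (a + ‖w‖ ^ 2 / 2) := by
    rw [Real.sqrt_le_left (by nlinarith)]
    rw [norm_add_sq_real, haR]
    nlinarith [sq_nonneg (a + ‖w‖ ^ 2 / 2), sq_nonneg ‖w‖, mul_nonneg (sub_nonneg.2 hR1) (sq_nonneg ‖w‖)]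
  have he : |a + ‖w‖ ^ 2 / 2| ≤ 1 := by
    rw [abs_le]; constructor <;> nlinarith
  -- This is exp u ≤ 1 + u + u² for |u| ≤ 1. As u² ≤ (16/9)‖w‖², the quadratic coefficient is at
  -- most 1/2 + 16/9 < 3.
  have hexp := (abs_le.1 (Real.abs_exp_sub_one_sub_id_le he)).2
  have hsq : (a + ‖w‖ ^ 2 / 2) ^ 2 ≤ (4 / 3 * ‖w‖) ^ 2 :=
    sq_le_sq' (by nlinarith) (by nlinarith)
  calc Real.exp √(1 + ‖y + w‖ ^ 2) ≤ Real.exp (R + (a + ‖w‖ ^ 2 / 2)) := Real.exp_le_exp.2 hsqrt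
    _ = Real.exp R * Real.exp (a + ‖w‖ ^ 2 / 2) := Real.exp_add _ _
    _ ≤ _ := by
      refine mul_le_mul_of_nonneg_left ?_ (Real.exp_pos _).le
      nlinarith

/-- Exponential moment of the norm of the centred dropout noise. -/
theorem sum_bitWeight_mul_exp_norm_le {m : ℕ} {p : ℝ} (hp0 : 0 < p) (hp1 : p ≤ 3 / 4)
    (v : Fin m → E) (hv : ∀ j, ‖v j‖ ≤ 2 / 9) :
    ∑ b : Fin m → Bool, (∏ j, bitWeight p (b j)) *
        Real.exp ‖∑ j, (multiplier p (b j) - 1) • v j‖ ≤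
      Real.exp (1 + 12 * p * ∑ j, ‖v j‖ ^ 2) := by
  have hp' : 0 < 1 - p := by linarith
  have main : ∀ s : Finset (Fin m), ∑ b : Fin m → Bool, (∏ j, bitWeight p (b j)) *
        Real.exp √(1 + ‖∑ j ∈ s, (multiplier p (b j) - 1) • v j‖ ^ 2) ≤
      Real.exp (1 + 12 * p * ∑ j ∈ s, ‖v j‖ ^ 2) := by
    intro s
    induction s using Finset.induction_on with
    | empty =>
      have : ∑ b : Fin m → Bool, (∏ j, bitWeight p (b j)) = 1 :=
        sum_prod_eq_one (fun _ => bitWeight p) fun _ => sum_bitWeight p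
      simp only [Finset.sum_empty, norm_zero]
      rw [← Finset.sum_mul, this]
      simp
    | insert i s hi ih =>
      rw [← sum_prod_mul_update (fun _ => bitWeight p) (fun _ => sum_bitWeight p) _ i]
      have step : ∀ b : Fin m → Bool, ∑ a, bitWeight p a * Real.exp √(1 +
            ‖∑ j ∈ insert i s, (multiplier p (Function.update b i a j) - 1) • v j‖ ^ 2) ≤
          Real.exp √(1 + ‖∑ j ∈ s, (multiplier p (b j) - 1) • v j‖ ^ 2) *
            Real.exp (12 * p * ‖v i‖ ^ 2) := by
        intro b
        have hsum : ∀ a, ∑ j ∈ insert i s, (multiplier p (Function.update b i a j) - 1) • v j =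
            (∑ j ∈ s, (multiplier p (b j) - 1) • v j) + (multiplier p a - 1) • v i := by
          intro a
          rw [Finset.sum_insert hi, Function.update_self, add_comm]
          congr 1
          refine Finset.sum_congr rfl fun j hj => ?_
          rw [Function.update_of_ne (fun h : j = i => hi (h ▸ hj))]
        set y := ∑ j ∈ s, (multiplier p (b j) - 1) • v j
        simp only [hsum]
        have hle : ∀ a, bitWeight p a * Real.exp √(1 + ‖y + (multiplier p a - 1) • v i‖ ^ 2) ≤
            bitWeight p a * (Real.exp √(1 + ‖y‖ ^ 2) *
              (1 + (multiplier p a - 1) * (inner ℝ y (v i) / √(1 + ‖y‖ ^ 2)) +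
                3 * ((multiplier p a - 1) ^ 2 * ‖v i‖ ^ 2))) := by
          intro a
          refine mul_le_mul_of_nonneg_left ?_ (bitWeight_nonneg hp0.le (by linarith) a)
          have habs := abs_multiplier_sub_one_le hp0 hp1 a
          have hn : ‖(multiplier p a - 1) • v i‖ ≤ 2 / 3 := by
            rw [norm_smul, Real.norm_eq_abs]
            calc _ ≤ 3 * (2 / 9 : ℝ) := mul_le_mul habs (hv i) (norm_nonneg _) (by norm_num)
              _ = 2 / 3 := by norm_num
          have := exp_sqrt_one_add_norm_sq_add_le y _ hn
          rw [inner_smul_right, norm_smul, mul_pow, Real.norm_eq_abs, sq_abs, mul_div_assoc] at this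
          exact this
        refine (Finset.sum_le_sum fun a _ => hle a).trans ?_
        simp only [Fintype.sum_bool, bitWeight, multiplier, if_true]
        simp only [Bool.false_eq_true, if_false]
        -- `h1` expresses that δ - 1 is centred. With `h2` its variance is at most 4p for p ≤ 3/4,
        -- whence 12p = 3 · 4p.
        have h1 : (1 - p) * (1 / (1 - p) - 1) = p := by field_simp; ring
        have h2 : (1 - p) * (1 / (1 - p) - 1) ^ 2 ≤ 3 * p := by
          have : 1 / (1 - p) - 1 ≤ 3 := by
            rw [sub_le_iff_le_add, div_le_iff₀ hp']; linarith
          calc _ = ((1 - p) * (1 / (1 - p) - 1)) * (1 / (1 - p) - 1) := by ring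
            _ ≤ p * 3 := by rw [h1]; gcongr
            _ = _ := by ring
        set e := Real.exp √(1 + ‖y‖ ^ 2)
        set r := inner ℝ y (v i) / √(1 + ‖y‖ ^ 2)
        have he : 0 < e := Real.exp_pos _
        calc _ = e * (1 + ((1 - p) * (1 / (1 - p) - 1) - p) * r +
              3 * (((1 - p) * (1 / (1 - p) - 1) ^ 2 + p) * ‖v i‖ ^ 2)) := by ring
          _ ≤ e * (1 + (p - p) * r + 3 * ((3 * p + p) * ‖v i‖ ^ 2)) := by
              rw [h1]; gcongr
          _ = e * (12 * p * ‖v i‖ ^ 2 + 1) := by ring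
          _ ≤ _ := mul_le_mul_of_nonneg_left (Real.add_one_le_exp _) he.le
      calc _ ≤ ∑ b : Fin m → Bool, (∏ j, bitWeight p (b j)) *
            (Real.exp √(1 + ‖∑ j ∈ s, (multiplier p (b j) - 1) • v j‖ ^ 2) *
            Real.exp (12 * p * ‖v i‖ ^ 2)) :=
            Finset.sum_le_sum fun b _ => mul_le_mul_of_nonneg_left (step b)
              (Finset.prod_nonneg fun j _ => bitWeight_nonneg hp0.le (by linarith) _)
        _ = (∑ b : Fin m → Bool, (∏ j, bitWeight p (b j)) *
            Real.exp √(1 + ‖∑ j ∈ s, (multiplier p (b j) - 1) • v j‖ ^ 2)) *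
            Real.exp (12 * p * ‖v i‖ ^ 2) := by
            rw [Finset.sum_mul]
            exact Finset.sum_congr rfl fun b _ => by ring
        _ ≤ Real.exp (1 + 12 * p * ∑ j ∈ s, ‖v j‖ ^ 2) * Real.exp (12 * p * ‖v i‖ ^ 2) := by
            gcongr
        _ = _ := by
            rw [← Real.exp_add, Finset.sum_insert hi]
            congr 1
            ring
  refine le_trans (Finset.sum_le_sum fun b _ => ?_) (main Finset.univ)
  refine mul_le_mul_of_nonneg_left (Real.exp_le_exp.2 ?_)
    (Finset.prod_nonneg fun j _ => bitWeight_nonneg hp0.le (by linarith) _)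
  exact Real.le_sqrt_of_sq_le (by linarith)

end ExpMoment

/-! ### The dropout law as a finite weighted sum -/

/-- The mass function of `dropoutLaw d h p`. -/
noncomputable def maskWeight {d : ℕ} {h : ℕ → ℕ} (p : ℝ) (w : Mask d h) : ℝ :=
  ∏ i, ∏ j, bitWeight p (w i j)

theorem maskWeight_nonneg {d : ℕ} {h : ℕ → ℕ} {p : ℝ} (hp0 : 0 ≤ p) (hp1 : p ≤ 1)
    (w : Mask d h) : 0 ≤ maskWeight p w :=
  Finset.prod_nonneg fun _ _ => Finset.prod_nonneg fun _ _ => bitWeight_nonneg hp0 hp1 _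

theorem isProbabilityMeasure_bitLaw {p : ℝ} (hp0 : 0 ≤ p) (hp1 : p ≤ 1) :
    IsProbabilityMeasure (bitLaw p) := by
  constructor
  simp only [bitLaw, Measure.coe_add, Measure.coe_smul, Pi.add_apply, Pi.smul_apply, measure_univ,
    smul_eq_mul, mul_one]
  rw [← ENNReal.ofReal_add hp0 (by linarith)]
  simp

theorem bitLaw_real_singleton {p : ℝ} (hp0 : 0 ≤ p) (hp1 : p ≤ 1) (b : Bool) :
    (bitLaw p).real {b} = bitWeight p b := by
  cases b <;> simp [Measure.real, bitLaw, bitWeight, hp0, hp1]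

theorem isProbabilityMeasure_dropoutLaw (d : ℕ) (h : ℕ → ℕ) {p : ℝ} (hp0 : 0 ≤ p) (hp1 : p ≤ 1) :
    IsProbabilityMeasure (dropoutLaw d h p) := by
  have := isProbabilityMeasure_bitLaw hp0 hp1
  unfold dropoutLaw
  infer_instance

theorem dropoutLaw_real_eq {d : ℕ} {h : ℕ → ℕ} {p : ℝ} (hp0 : 0 ≤ p) (hp1 : p ≤ 1)
    (s : Finset (Mask d h)) :
    (dropoutLaw d h p).real (s : Set (Mask d h)) = ∑ w ∈ s, maskWeight p w := by
  have := isProbabilityMeasure_bitLaw hp0 hp1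
  have := isProbabilityMeasure_dropoutLaw d h hp0 hp1
  rw [← sum_measureReal_singleton]
  refine Finset.sum_congr rfl fun w _ => ?_
  simp only [Measure.real, dropoutLaw, Measure.pi_singleton, ENNReal.toReal_prod, maskWeight,
    ← bitLaw_real_singleton hp0 hp1]

/-- Markov's inequality for the dropout law. -/
theorem dropoutLaw_real_le {d : ℕ} {h : ℕ → ℕ} {p : ℝ} (hp0 : 0 ≤ p) (hp1 : p ≤ 1)
    (P : Mask d h → Prop) (f : Mask d h → ℝ) (hf : ∀ w, 0 ≤ f w) (hP : ∀ w, P w → 1 ≤ f w) :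
    (dropoutLaw d h p).real {w | P w} ≤ ∑ w, maskWeight p w * f w := by
  classical
  have : {w | P w} = ((Finset.univ.filter P : Finset (Mask d h)) : Set (Mask d h)) := by simp
  rw [this, dropoutLaw_real_eq hp0 hp1]
  calc _ ≤ ∑ w ∈ Finset.univ.filter P, maskWeight p w * f w := by
        refine Finset.sum_le_sum fun w hw => ?_
        exact le_mul_of_one_le_right (maskWeight_nonneg hp0 hp1 w) (hP w (by simpa using hw))
    _ ≤ _ := Finset.sum_le_sum_of_subset_of_nonneg (Finset.filter_subset _ _)
        fun w _ _ => mul_nonneg (maskWeight_nonneg hp0 hp1 w) (hf w)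

/-- A unit-by-unit Chernoff bound: it is unlikely that more than half of a layer is kept. -/
theorem dropoutLaw_real_kept_le {d : ℕ} {h : ℕ → ℕ} (i : Fin (d - 1)) :
    (dropoutLaw d h (3 / 4)).real
        {w | h (i + 1) / 2 < (Finset.univ.filter fun j => w i j = true).card} ≤
      Real.exp (-(h (i + 1) : ℝ) / 8) := by
  have h34 : (0 : ℝ) ≤ 3 / 4 := by norm_num
  have h34' : (3 / 4 : ℝ) ≤ 1 := by norm_num
  set H := h (i + 1) with hH
  have hs0 : (0 : ℝ) < √3 := by positivity
  have hs1 : (1 : ℝ) ≤ √3 := Real.one_le_sqrt.2 (by norm_num)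
  have hs2 : √3 ^ 2 = (3 : ℝ) := Real.sq_sqrt (by norm_num)
  have hb : ∀ b : Fin H → Bool, ∏ j, (if b j then (3 : ℝ) else 1) =
      √3 ^ (2 * (Finset.univ.filter fun j => b j = true).card) := by
    intro b
    rw [pow_mul, hs2, Finset.prod_ite, Finset.prod_const, Finset.prod_const_one, mul_one]
  -- Exponential tilt by 3 per kept unit, the optimal choice for keeping probability 1/4 and
  -- threshold 1/2. Each unit contributes (3/4 + 3/4)/√3 = √3/2 ≤ 7/8 ≤ exp(-1/8).
  refine (dropoutLaw_real_le h34 h34' _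
    (fun w => (∏ j, (if w i j then (3 : ℝ) else 1)) / √3 ^ H) (fun w => ?_) fun w hw => ?_).trans ?_
  · exact div_nonneg (Finset.prod_nonneg fun j _ => by split_ifs <;> norm_num) (by positivity)
  · rw [hb, le_div_iff₀ (by positivity), one_mul]
    refine pow_le_pow_right₀ hs1 ?_
    have double : ∀ a b : ℕ, a / 2 < b → a ≤ 2 * b := by omega
    exact double _ _ hw
  · have key : ∑ b : Fin H → Bool, (∏ j, bitWeight (3 / 4) (b j)) *
        ((∏ j, (if b j then (3 : ℝ) else 1)) / √3 ^ H) = (3 / 2) ^ H / √3 ^ H := by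
      simp_rw [← mul_div_assoc, ← Finset.sum_div, ← Finset.prod_mul_distrib]
      congr 1
      have := (Finset.prod_univ_sum (fun _ : Fin H => (Finset.univ : Finset Bool))
        (fun _ b => bitWeight (3 / 4) b * (if b then (3 : ℝ) else 1))).symm
      rw [Fintype.piFinset_univ] at this
      rw [this]
      simp [bitWeight]
      norm_num
    have hone : ∀ k : Fin (d - 1), ∑ b : Fin (h (k + 1)) → Bool, ∏ j, bitWeight (3 / 4) (b j) = 1 :=
      fun k => sum_prod_eq_one (fun _ => bitWeight (3 / 4)) fun _ => sum_bitWeight _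
    have hav := sum_prod_mul_update
      (fun (k : Fin (d - 1)) (b : Fin (h (k + 1)) → Bool) => ∏ j, bitWeight (3 / 4) (b j)) hone
      (fun w : Mask d h => (∏ j, (if w i j then (3 : ℝ) else 1)) / √3 ^ H) i
    simp only [Function.update_self] at hav
    unfold maskWeight
    rw [← hav, key, ← Finset.sum_mul]
    have htot : ∑ w : Mask d h, ∏ k, ∏ j, bitWeight (3 / 4) (w k j) = 1 := sum_prod_eq_one
      (fun (k : Fin (d - 1)) (b : Fin (h (k + 1)) → Bool) => ∏ j, bitWeight (3 / 4) (b j)) hone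
    rw [htot, one_mul, ← div_pow]
    have h1 : 3 / 2 / √3 ≤ Real.exp (-(1 / 8)) := by
      have : (-(1 / 8) : ℝ) + 1 ≤ Real.exp (-(1 / 8)) := Real.add_one_le_exp _
      refine le_trans ?_ this
      rw [div_le_iff₀ hs0]
      have : (12 / 7 : ℝ) ≤ √3 := Real.le_sqrt_of_sq_le (by norm_num)
      linarith
    calc _ ≤ Real.exp (-(1 / 8)) ^ H := by gcongr
      _ = Real.exp (-(H : ℝ) / 8) := by
        rw [← Real.exp_nat_mul]
        congr 1
        ring

end ReluNet

namespace ReluNet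

/-! ### Linear algebra of the layers -/

theorem norm_toEuclideanLin_le {m n : ℕ} (A : Matrix (Fin m) (Fin n) ℝ) (v : Vec n) :
    ‖Matrix.toEuclideanLin A v‖ ≤ ‖A‖ * ‖v‖ :=
  Matrix.l2_opNorm_mulVec A v

theorem toEuclideanLin_eq_sum {m n : ℕ} (A : Matrix (Fin m) (Fin n) ℝ) (v : Vec n) :
    Matrix.toEuclideanLin A v = ∑ j, v j • column A j := by
  ext r
  simp [Matrix.toLpLin_apply, Matrix.mulVec, dotProduct, column, mul_comm]

theorem toEuclideanLin_scaleColumns {m n : ℕ} (A : Matrix (Fin m) (Fin n) ℝ) (s : Fin n → ℝ)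
    (v : Vec n) :
    Matrix.toEuclideanLin (scaleColumns A s) v = ∑ j, s j • v j • column A j := by
  ext r
  simp [Matrix.toLpLin_apply, Matrix.mulVec, dotProduct, column, scaleColumns, mul_comm,
    mul_left_comm, mul_assoc]

theorem norm_scaleColumns_le {m n : ℕ} (A : Matrix (Fin m) (Fin n) ℝ) (s : Fin n → ℝ) {b : ℝ}
    (hb : 0 ≤ b) (hs : ∀ j, |s j| ≤ b) : ‖scaleColumns A s‖ ≤ ‖A‖ * b := by
  have h1 : scaleColumns A s = A * Matrix.diagonal s := by
    ext r j
    simp [scaleColumns, mul_comm]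
  rw [h1]
  refine (Matrix.l2_opNorm_mul _ _).trans ?_
  rw [Matrix.l2_opNorm_diagonal]
  gcongr
  exact (pi_norm_le_iff_of_nonneg hb).2 hs

theorem frob_nonneg {m n : ℕ} (A : Matrix (Fin m) (Fin n) ℝ) : 0 ≤ frob A := Real.sqrt_nonneg _

theorem frob_sq {m n : ℕ} (A : Matrix (Fin m) (Fin n) ℝ) :
    frob A ^ 2 = ∑ j, ‖column A j‖ ^ 2 := by
  rw [frob, Real.sq_sqrt (by positivity), Finset.sum_comm]
  simp [EuclideanSpace.norm_sq_eq, column]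

theorem column_eq_zero {m n : ℕ} {A : Matrix (Fin m) (Fin n) ℝ} (hA : frob A = 0) (j : Fin n) :
    column A j = 0 := by
  have := frob_sq A
  rw [hA, zero_pow two_ne_zero, eq_comm,
    Finset.sum_eq_zero_iff_of_nonneg fun _ _ => by positivity] at this
  simpa using this j (Finset.mem_univ j)

theorem norm_relu_sub_le {n : ℕ} (v w : Vec n) : ‖relu v - relu w‖ ≤ ‖v - w‖ := by
  rw [EuclideanSpace.norm_eq, EuclideanSpace.norm_eq]
  refine Real.sqrt_le_sqrt (Finset.sum_le_sum fun k _ => ?_)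
  have : |max (v k) 0 - max (w k) 0| ≤ |v k - w k| := abs_max_sub_max_le_abs _ _ _
  simpa [relu] using pow_le_pow_left₀ (abs_nonneg _) this 2

theorem relu_zero {n : ℕ} : relu (0 : Vec n) = 0 := by
  ext k
  simp [relu]

theorem norm_relu_le {n : ℕ} (v : Vec n) : ‖relu v‖ ≤ ‖v‖ := by
  simpa [relu_zero] using norm_relu_sub_le v 0

theorem norm_act_sub_le {h : ℕ → ℕ} (i : ℕ) (v w : Vec (h i)) :
    ‖act i v - act i w‖ ≤ ‖v - w‖ := by
  cases i with
  | zero => exact le_rfl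
  | succ i => exact norm_relu_sub_le v w

theorem act_zero {h : ℕ → ℕ} (i : ℕ) : act i (0 : Vec (h i)) = 0 := by
  cases i with
  | zero => rfl
  | succ i => exact relu_zero

theorem norm_act_le {h : ℕ → ℕ} (i : ℕ) (v : Vec (h i)) : ‖act i v‖ ≤ ‖v‖ := by
  simpa [act_zero] using norm_act_sub_le i v 0

/-- ReLU is positively homogeneous of degree one, so φ'(v) v = φ(v). At v = 0 both sides vanish,
whatever value φ'(0) is given. -/
theorem toEuclideanLin_diagonal_actDeriv {h : ℕ → ℕ} (i : ℕ) (v : Vec (h i)) :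
    Matrix.toEuclideanLin (Matrix.diagonal (actDeriv i v)) v = act i v := by
  ext k
  rw [Matrix.toLpLin_apply]
  simp only [Matrix.mulVec_diagonal]
  cases i with
  | zero => simp [act, actDeriv]
  | succ i =>
    simp only [act, actDeriv, relu]
    split_ifs with hv
    · simp [hv.le]
    · simp [not_lt.1 hv]

theorem toEuclideanLin_mul {l m n : ℕ} (A : Matrix (Fin l) (Fin m) ℝ)
    (B : Matrix (Fin m) (Fin n) ℝ) (v : Vec n) :
    Matrix.toEuclideanLin (A * B) v = Matrix.toEuclideanLin A (Matrix.toEuclideanLin B v) := by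
  ext r
  simp [Matrix.toLpLin_apply, Matrix.mulVec_mulVec]

/-- A ReLU network is positively homogeneous: it agrees with its Jacobian at the base point. -/
theorem toEuclideanLin_jacobian {h : ℕ → ℕ} (θ : Params h) (i k : ℕ) (v : Vec (h i)) :
    Matrix.toEuclideanLin (jacobian θ i k v) v = layerMap θ i k v := by
  induction k with
  | zero =>
    ext r
    simp [jacobian, layerMap]
  | succ k ih =>
    rw [jacobian, toEuclideanLin_mul, ih, toEuclideanLin_mul, toEuclideanLin_diagonal_actDeriv]
    rfl

theorem layerMap_preact {h : ℕ → ℕ} (θ : Params h) (x : Vec (h 0)) (i k : ℕ) :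
    layerMap θ i k (preact θ x i) = preact θ x (i + k) := by
  induction k with
  | zero => rfl
  | succ k ih =>
    rw [layerMap, ih]
    rfl

theorem layerMap_congr {h : ℕ → ℕ} {θ θ' : Params h} {i : ℕ} (hθ : ∀ j, i ≤ j → θ j = θ' j)
    (k : ℕ) (v : Vec (h i)) : layerMap θ i k v = layerMap θ' i k v := by
  induction k with
  | zero => rfl
  | succ k ih =>
    rw [layerMap, layerMap, ih, step, step, hθ _ (by omega)]

theorem preact_congr {h : ℕ → ℕ} {θ θ' : Params h} (x : Vec (h 0)) {j : ℕ}
    (hθ : ∀ i, i < j → θ i = θ' i) : preact θ x j = preact θ' x j := by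
  induction j with
  | zero => rfl
  | succ j ih =>
    rw [preact, preact, ih fun i hi => hθ i (by omega), step, step, hθ j (by omega)]

/-! ### The partially dropped-out networks -/

section Dropout

variable {d : ℕ} {h : ℕ → ℕ} {p : ℝ} {w : Mask d h} {θ : Params h}

theorem dropUpTo_of_le {n i : ℕ} (hn : n ≤ i) : dropUpTo p w θ n i = θ i := by
  cases i with
  | zero => rfl
  | succ i => simp [dropUpTo, show ¬ i + 2 ≤ n by omega]

theorem dropUpTo_one : dropUpTo p w θ 1 = θ := by
  funext i
  cases i with
  | zero => rfl
  | succ i => exact dropUpTo_of_le (by omega)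

theorem dropUpTo_eq_of_lt {n n' i : ℕ} (hn : i < n) (hn' : i < n') :
    dropUpTo p w θ n i = dropUpTo p w θ n' i := by
  cases i with
  | zero => rfl
  | succ i => simp [dropUpTo, show i + 2 ≤ n by omega, show i + 2 ≤ n' by omega]

/-- The mask with index m acts on the weights of layer m + 2. This is the source of adaptedness:
what enters that layer does not see its mask or any later one. -/
theorem dropUpTo_update {m : Fin (d - 1)} (a : Fin (h (m + 1)) → Bool) {n : ℕ} (hn : n < m + 2) :
    dropUpTo p (Function.update w m a) θ n = dropUpTo p w θ n := by
  funext i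
  cases i with
  | zero => rfl
  | succ i =>
    simp only [dropUpTo]
    split_ifs with h1 h2
    · rw [Function.update_of_ne]
      rintro rfl
      simp at hn
      omega
    all_goals rfl

theorem onSegment_apply (θ θ' : Params h) (t : ℝ) (i : ℕ) :
    onSegment θ θ' t i = θ i + t • (θ' i - θ i) := rfl

/-- The change of the preactivation of layer `m + 2` caused by the dropout of that layer. -/
theorem preact_sub_preact {t : ℝ} (x : Vec (h 0)) (m : Fin (d - 1)) :
    preact (onSegment θ (dropUpTo p w θ (m + 2)) t) x (m + 2) -
        preact (onSegment θ (dropUpTo p w θ (m + 1)) t) x (m + 2) =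
      t • Matrix.toEuclideanLin (scaleColumns (θ (m + 1)) fun j => multiplier p (w m j) - 1)
        (relu (preact (onSegment θ (dropUpTo p w θ (m + 1)) t) x (m + 1))) := by
  have h1 : preact (onSegment θ (dropUpTo p w θ (m + 2)) t) x (m + 1) =
      preact (onSegment θ (dropUpTo p w θ (m + 1)) t) x (m + 1) :=
    preact_congr x fun i hi => by
      rw [onSegment_apply, onSegment_apply, dropUpTo_eq_of_lt (n' := m + 1) (by omega) hi]
  change step _ (m + 1) (preact _ x (m + 1)) - step _ (m + 1) (preact _ x (m + 1)) = _
  rw [h1, step, step]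
  simp only [act, onSegment_apply]
  rw [dropUpTo_of_le (n := m + 1) le_rfl, sub_self, smul_zero, add_zero]
  have h2 : dropUpTo p w θ (m + 2) (m + 1) - θ (m + 1) =
      scaleColumns (θ (m + 1)) fun j => multiplier p (w m j) - 1 := by
    ext r j
    simp [dropUpTo, scaleColumns, sub_mul]
  rw [h2, map_add, map_smul, LinearMap.add_apply, LinearMap.smul_apply, add_sub_cancel_left]

/-- Beyond layer n both ends of the segment carry the original weights, so the noise is propagated
by the undropped network. The variant starting at n + 1 treats x̂^i_{i-1}, whose own layer is not
dropped. -/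
theorem preact_onSegment_eq_layerMap {t : ℝ} (x : Vec (h 0)) (n k : ℕ) :
    preact (onSegment θ (dropUpTo p w θ n) t) x (n + k) =
      layerMap θ n k (preact (onSegment θ (dropUpTo p w θ n) t) x n) := by
  rw [← layerMap_preact]
  refine layerMap_congr (fun j hj => ?_) _ _
  rw [onSegment_apply, dropUpTo_of_le hj, sub_self, smul_zero, add_zero]

theorem preact_onSegment_succ_eq_layerMap {t : ℝ} (x : Vec (h 0)) (n k : ℕ) :
    preact (onSegment θ (dropUpTo p w θ n) t) x (n + 1 + k) =
      layerMap θ (n + 1) k (preact (onSegment θ (dropUpTo p w θ n) t) x (n + 1)) := by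
  rw [← layerMap_preact]
  refine layerMap_congr (fun j hj => ?_) _ _
  rw [onSegment_apply, dropUpTo_of_le (by omega), sub_self, smul_zero, add_zero]

end Dropout

/-! ### Cushions -/

section Cushions

variable {d : ℕ} {h : ℕ → ℕ} {S : Sample d h} {θ : Params h}

/-- Layers without bias fix zero, so a vanishing preactivation would force a vanishing output. All
denominators of the cushions are nonzero for this reason. -/
theorem preact_ne_zero {x : Vec (h 0)} (hx : output d θ x ≠ 0) {i : ℕ} (hi : i ≤ d) :
    preact θ x i ≠ 0 := by
  obtain ⟨k, rfl⟩ := Nat.exists_eq_add_of_le hi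
  intro h0
  apply hx
  have : ∀ k, layerMap θ i k 0 = 0 := by
    intro k
    induction k with
    | zero => rfl
    | succ k ih => rw [layerMap, ih, step, act_zero, map_zero]
  rw [output, ← layerMap_preact, h0, this]

theorem relu_preact_ne_zero {x : Vec (h 0)} (hx : output d θ x ≠ 0) {i : ℕ} (hi : i + 1 < d) :
    relu (preact θ x (i + 1)) ≠ 0 := by
  intro h0
  refine preact_ne_zero hx (i := i + 2) hi ?_
  rw [preact, step, act, h0, map_zero]

theorem layerCushion_le {z : Vec (h 0) × Vec (h d)} (hz : z ∈ S) (i : ℕ) :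
    layerCushion S θ i ≤ ‖Matrix.toEuclideanLin (θ i) (act i (preact θ z.1 i))‖ /
      (frob (θ i) * ‖act i (preact θ z.1 i)‖) :=
  ciInf_le (Finite.bddBelow_range _) (⟨z, hz⟩ : S)

theorem layerCushion_mul_le {z : Vec (h 0) × Vec (h d)} (hz : z ∈ S) (i : ℕ) :
    layerCushion S θ i * (frob (θ i) * ‖act i (preact θ z.1 i)‖) ≤ ‖preact θ z.1 (i + 1)‖ :=
  mul_le_of_le_div₀ (norm_nonneg _) (mul_nonneg (frob_nonneg _) (norm_nonneg _))
    (layerCushion_le hz i)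

theorem minInterlayerCushion_le {z : Vec (h 0) × Vec (h d)} (hz : z ∈ S) {i k : ℕ}
    (hik : i + k ≤ d) :
    minInterlayerCushion S θ i ≤
      ‖Matrix.toEuclideanLin (jacobian θ i k (preact θ z.1 i)) (preact θ z.1 i)‖ /
        (‖jacobian θ i k (preact θ z.1 i)‖ * ‖preact θ z.1 i‖) :=
  (ciInf_le (Finite.bddBelow_range _) (⟨k, by omega⟩ : Fin (d - i + 1))).trans
    (ciInf_le (Finite.bddBelow_range _) (⟨z, hz⟩ : S))

/-- By homogeneity the Jacobian sends x^i to x^j, so the cushion bounds ‖J‖ by the true growth ‖x^j‖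
/ ‖x^i‖. -/
theorem minInterlayerCushion_mul_le {z : Vec (h 0) × Vec (h d)} (hz : z ∈ S) {i k : ℕ}
    (hik : i + k ≤ d) :
    minInterlayerCushion S θ i * (‖jacobian θ i k (preact θ z.1 i)‖ * ‖preact θ z.1 i‖) ≤
      ‖preact θ z.1 (i + k)‖ := by
  have := mul_le_of_le_div₀ (norm_nonneg _) (by positivity) (minInterlayerCushion_le (θ := θ) hz hik)
  rwa [toEuclideanLin_jacobian, layerMap_preact] at this

theorem minInterlayerCushion_le_one (hS : S.Nonempty) {i : ℕ} (hi : i ≤ d) :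
    minInterlayerCushion S θ i ≤ 1 := by
  obtain ⟨z, hz⟩ := hS
  exact (minInterlayerCushion_le hz (k := 0) hi).trans
    (div_le_one_of_le₀ (norm_toEuclideanLin_le _ _) (by positivity))

theorem ciInf_pos_of_finite {ι : Type*} [Finite ι] [Nonempty ι] {f : ι → ℝ} (hf : ∀ i, 0 < f i) :
    0 < ⨅ i, f i := by
  obtain ⟨i, hi⟩ := exists_eq_ciInf_of_finite (f := f)
  exact hi ▸ hf i

theorem layerCushion_pos (hS : S.Nonempty) (hout : ∀ z ∈ S, output d θ z.1 ≠ 0) {i : ℕ}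
    (hi : i < d) : 0 < layerCushion S θ i := by
  have : Nonempty S := hS.to_subtype
  refine ciInf_pos_of_finite fun z => ?_
  have h1 : 0 < ‖Matrix.toEuclideanLin (θ i) (act i (preact θ z.1.1 i))‖ :=
    norm_pos_iff.2 (preact_ne_zero (hout z.1 z.2) (i := i + 1) hi)
  have h2 : 0 < ‖act i (preact θ z.1.1 i)‖ := by
    refine norm_pos_iff.2 fun h0 => ?_
    simp [h0] at h1
  have h3 : 0 < frob (θ i) := by
    refine (frob_nonneg _).lt_of_ne' fun h0 => ?_
    rw [toEuclideanLin_eq_sum] at h1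
    simp [column_eq_zero h0] at h1
  positivity

theorem minInterlayerCushion_pos (hS : S.Nonempty) (hout : ∀ z ∈ S, output d θ z.1 ≠ 0) {i : ℕ}
    (hi : i ≤ d) : 0 < minInterlayerCushion S θ i := by
  have : Nonempty S := hS.to_subtype
  refine ciInf_pos_of_finite fun k => ciInf_pos_of_finite fun z => ?_
  have h1 : 0 < ‖Matrix.toEuclideanLin (jacobian θ i k (preact θ z.1.1 i)) (preact θ z.1.1 i)‖ := by
    rw [toEuclideanLin_jacobian, layerMap_preact]
    exact norm_pos_iff.2 (preact_ne_zero (hout z.1 z.2) (by omega))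
  have h2 := h1.trans_le (norm_toEuclideanLin_le _ _)
  positivity

theorem minCushion_le (m : Fin (d - 1)) :
    minCushion S θ ≤ layerCushion S θ (m + 1) * minInterlayerCushion S θ (m + 2) :=
  ciInf_le (Finite.bddBelow_range _) m

theorem minCushion_pos (hd : 2 ≤ d) (hS : S.Nonempty) (hout : ∀ z ∈ S, output d θ z.1 ≠ 0) :
    0 < minCushion S θ := by
  have : Nonempty (Fin (d - 1)) := ⟨⟨0, by omega⟩⟩
  exact ciInf_pos_of_finite fun m => mul_pos (layerCushion_pos hS hout (by omega))
    (minInterlayerCushion_pos hS hout (by omega))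

theorem norm_preact_le (hout : ∀ z ∈ S, output d θ z.1 ≠ 0) {z : Vec (h 0) × Vec (h d)}
    (hz : z ∈ S) (m : Fin (d - 1)) :
    ‖preact θ z.1 (m + 1)‖ ≤ activationContraction S θ * ‖relu (preact θ z.1 (m + 1))‖ := by
  have h0 : 0 < ‖relu (preact θ z.1 (m + 1))‖ :=
    norm_pos_iff.2 (relu_preact_ne_zero (hout z hz) (by omega))
  rw [← div_le_iff₀ h0]
  exact (le_ciSup (f := fun m : Fin (d - 1) => ‖preact θ z.1 (m + 1)‖ /
    ‖relu (preact θ z.1 (m + 1))‖) (Finite.bddAbove_range _) m).trans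
    (le_ciSup (f := fun z : S => ⨆ i : Fin (d - 1), ‖preact θ z.1.1 (i + 1)‖ /
      ‖relu (preact θ z.1.1 (i + 1))‖) (Finite.bddAbove_range _) ⟨z, hz⟩)

theorem activationContraction_pos (hd : 2 ≤ d) (hS : S.Nonempty)
    (hout : ∀ z ∈ S, output d θ z.1 ≠ 0) : 0 < activationContraction S θ := by
  obtain ⟨z, hz⟩ := hS
  have h1 := norm_preact_le hout hz ⟨0, by omega⟩
  have h2 : 0 < ‖preact θ z.1 (0 + 1)‖ := norm_pos_iff.2 (preact_ne_zero (hout z hz) (by omega))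
  exact pos_of_mul_pos_left (h2.trans_le h1) (norm_nonneg _)

end Cushions

/-! ### Propagation of the dropout noise -/

section Propagation

variable {d : ℕ} {h : ℕ → ℕ} {S : Sample d h} {θ : Params h} {p ρ : ℝ} {w : Mask d h}

/-- The effect of the dropout of layer `m + 2` on the relative error of all later layers. -/
theorem norm_preact_sub_le_step (hd : 2 ≤ d) (hS : S.Nonempty)
    (hout : ∀ z ∈ S, output d θ z.1 ≠ 0) (hρ : 3 * (d : ℝ) ≤ ρ) (hsm : SmoothFor S θ p ρ w)
    {z : Vec (h 0) × Vec (h d)} (hz : z ∈ S) {t : ℝ} (ht : t ∈ Set.Icc (0 : ℝ) 1)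
    (m : Fin (d - 1)) {η q : ℝ} (hη0 : 0 ≤ η) (hq0 : 0 ≤ q)
    (hη : ‖Matrix.toEuclideanLin (scaleColumns (θ (m + 1)) fun j => multiplier p (w m j) - 1)
        (relu (preact (onSegment θ (dropUpTo p w θ (m + 1)) t) z.1 (m + 1)))‖ ≤
      η * (frob (θ (m + 1)) *
        ‖relu (preact (onSegment θ (dropUpTo p w θ (m + 1)) t) z.1 (m + 1))‖))
    (hq : ∀ j : ℕ, (m : ℕ) + 1 ≤ j → j ≤ d →
      ‖preact (onSegment θ (dropUpTo p w θ (m + 1)) t) z.1 j - preact θ z.1 j‖ ≤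
        q * ‖preact θ z.1 j‖)
    {j : ℕ} (hmj : (m : ℕ) + 2 ≤ j) (hjd : j ≤ d) :
    ‖preact (onSegment θ (dropUpTo p w θ (m + 2)) t) z.1 j - preact θ z.1 j‖ ≤
      (q * (1 + 2 * (activationContraction S θ / minCushion S θ * η) + 1 / d) +
        2 * (activationContraction S θ / minCushion S θ * η)) * ‖preact θ z.1 j‖ := by
  obtain ⟨k, rfl⟩ := Nat.exists_eq_add_of_le hmj
  set α := activationContraction S θ / minCushion S θ * η with hα
  set c := activationContraction S θ
  have hμ0 := minCushion_pos (θ := θ) hd hS hout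
  have hc0 : 0 < c := activationContraction_pos hd hS hout
  have hl0 := layerCushion_pos (θ := θ) hS hout (i := m + 1) (by omega)
  have hi0 := minInterlayerCushion_pos (θ := θ) hS hout (i := m + 2) (by omega)
  have hi1 := minInterlayerCushion_le_one (θ := θ) hS (i := m + 2) (by omega)
  set μ := layerCushion S θ (m + 1)
  set ν := minInterlayerCushion S θ (m + 2)
  have hμν : minCushion S θ ≤ μ * ν := minCushion_le m
  have hd0 : (0 : ℝ) < d := by
    have : 0 < d := by omega
    exact_mod_cast this
  have hρ0 : 0 < ρ := by linarith
  have hJ := minInterlayerCushion_mul_le (θ := θ) hz hjd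
  have hLC := layerCushion_mul_le (θ := θ) hz (m + 1)
  have hC := norm_preact_le (θ := θ) hout hz m
  have hs1 := hsm z hz (m + 2) k (by omega) hjd (m + 2) (Or.inl rfl) t ht
  have hs2 := hsm z hz (m + 2) k (by omega) hjd (m + 1) (Or.inr rfl) t ht
  have hdiff := preact_sub_preact (p := p) (w := w) (θ := θ) (t := t) z.1 m
  have hq1 := hq (m + 1) le_rfl (by omega)
  have hq2 := hq (m + 2) (by omega) (by omega)
  have hqj := hq (m + 2 + k) (by omega) hjd
  rw [preact_onSegment_eq_layerMap]
  rw [preact_onSegment_succ_eq_layerMap] at hqj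
  have hx0 : 0 < ‖preact θ z.1 (m + 2)‖ := norm_pos_iff.2 (preact_ne_zero (hout z hz) (by omega))
  set J := jacobian θ (m + 2) k (preact θ z.1 (m + 2))
  set y := preact (onSegment θ (dropUpTo p w θ (m + 1)) t) z.1 (m + 1)
  set v := preact (onSegment θ (dropUpTo p w θ (m + 2)) t) z.1 (m + 2)
  set v' := preact (onSegment θ (dropUpTo p w θ (m + 1)) t) z.1 (m + 2)
  set x := preact θ z.1 (m + 2)
  set xj := preact θ z.1 (m + 2 + k)
  have hxj := norm_nonneg xj
  have hα0 : 0 ≤ α := by positivity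
  -- The factor ν is retained because it offsets ‖J‖ in `hJv`. Where J plays no role it is discarded
  -- through ν ≤ 1.
  have hvv : ‖v - v'‖ ≤ ν * α * (1 + q) * ‖x‖ := by
    have hy : ‖relu y‖ ≤ (1 + q) * (c * ‖relu (preact θ z.1 (m + 1))‖) := by
      calc ‖relu y‖ ≤ ‖y‖ := norm_relu_le y
        _ = ‖preact θ z.1 (m + 1) + (y - preact θ z.1 (m + 1))‖ := by congr 1; abel
        _ ≤ ‖preact θ z.1 (m + 1)‖ + q * ‖preact θ z.1 (m + 1)‖ :=
            (norm_add_le _ _).trans (by gcongr)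
        _ = (1 + q) * ‖preact θ z.1 (m + 1)‖ := by ring
        _ ≤ _ := by gcongr
    have hF := frob_nonneg (θ (m + 1))
    rw [hdiff, norm_smul, Real.norm_eq_abs, abs_of_nonneg ht.1]
    have h1 : frob (θ (m + 1)) * ‖relu (preact θ z.1 (m + 1))‖ ≤ ‖x‖ / μ := by
      rw [le_div_iff₀' hl0]
      exact hLC
    calc _ ≤ 1 * (η * (frob (θ (m + 1)) * ‖relu y‖)) := by
          gcongr
          exact ht.2
      _ ≤ 1 * (η * (frob (θ (m + 1)) * ((1 + q) * (c * ‖relu (preact θ z.1 (m + 1))‖)))) := by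
          gcongr
      _ = η * (1 + q) * c * (frob (θ (m + 1)) * ‖relu (preact θ z.1 (m + 1))‖) := by ring
      _ ≤ η * (1 + q) * c * (‖x‖ / μ) := by gcongr
      _ = η * (1 + q) * c * ‖x‖ * (1 / μ) := by ring
      _ ≤ η * (1 + q) * c * ‖x‖ * (ν / minCushion S θ) := by
          refine mul_le_mul_of_nonneg_left ?_ (by positivity)
          rw [div_le_div_iff₀ hl0 hμ0]
          linarith
      _ = _ := by rw [hα]; ring
  have hJv : ‖Matrix.toEuclideanLin J (v - v')‖ ≤ α * (1 + q) * ‖xj‖ := by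
    refine (norm_toEuclideanLin_le _ _).trans ?_
    calc ‖J‖ * ‖v - v'‖ ≤ ‖J‖ * (ν * α * (1 + q) * ‖x‖) := by gcongr
      _ = α * (1 + q) * (ν * (‖J‖ * ‖x‖)) := by ring
      _ ≤ _ := by gcongr
  have hvv' : ‖v - v'‖ ≤ α * (1 + q) * ‖x‖ := hvv.trans (by
    gcongr
    exact mul_le_of_le_one_left hα0 hi1)
  have hvx : ‖v - x‖ ≤ (α * (1 + q) + q) * ‖x‖ := by
    calc ‖v - x‖ = ‖(v - v') + (v' - x)‖ := by congr 1; abel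
      _ ≤ α * (1 + q) * ‖x‖ + q * ‖x‖ := (norm_add_le _ _).trans (add_le_add hvv' hq2)
      _ = _ := by ring
  have hs1' : ‖layerMap θ (m + 2) k v - Matrix.toEuclideanLin J v‖ ≤
      (α * (1 + q) + q) / ρ * ‖xj‖ := by
    refine hs1.trans ?_
    rw [div_le_iff₀ (by positivity)]
    calc _ ≤ (α * (1 + q) + q) * ‖x‖ * ‖xj‖ := by gcongr
      _ = _ := by field_simp
  have hs2' : ‖layerMap θ (m + 2) k v' - Matrix.toEuclideanLin J v'‖ ≤ q / ρ * ‖xj‖ := by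
    refine hs2.trans ?_
    rw [div_le_iff₀ (by positivity)]
    calc _ ≤ q * ‖x‖ * ‖xj‖ := by gcongr
      _ = _ := by field_simp
  -- Linearization errors at v and at v', linear transport of the new noise, and the error inherited
  -- from earlier layers.
  have hsplit : layerMap θ (m + 2) k v - xj =
      (layerMap θ (m + 2) k v - Matrix.toEuclideanLin J v) -
        (layerMap θ (m + 2) k v' - Matrix.toEuclideanLin J v') +
        Matrix.toEuclideanLin J (v - v') + (layerMap θ (m + 2) k v' - xj) := by
    rw [map_sub]
    abel
  have hρ1 : 1 / ρ ≤ 1 / (3 * d) := one_div_le_one_div_of_le (by positivity) hρ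
  have hd2 : (2 : ℝ) ≤ d := by exact_mod_cast hd
  have hρ2 : 1 / ρ ≤ 1 := hρ1.trans (by rw [div_le_one (by positivity)]; linarith)
  -- The two linearization errors together cost at most q/d on the inherited part, so compounding
  -- over d layers costs at most a factor e.
  have hρ3 : 2 * (1 / ρ) ≤ 1 / d := by
    have : 1 / (3 * (d : ℝ)) = 1 / 3 * (1 / d) := by field_simp
    have : 0 < 1 / (d : ℝ) := by positivity
    linarith
  calc ‖layerMap θ (m + 2) k v - xj‖ ≤
        (α * (1 + q) + q) / ρ * ‖xj‖ + q / ρ * ‖xj‖ + α * (1 + q) * ‖xj‖ + q * ‖xj‖ := by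
        rw [hsplit]
        refine (norm_add_le _ _).trans (add_le_add ((norm_add_le _ _).trans (add_le_add
          ((norm_sub_le _ _).trans (add_le_add hs1' hs2')) hJv)) hqj)
    _ = (α * (1 + q) * (1 / ρ) + q * (2 * (1 / ρ)) + α * (1 + q) + q) * ‖xj‖ := by ring
    _ ≤ (α * (1 + q) * 1 + q * (1 / d) + α * (1 + q) + q) * ‖xj‖ := by gcongr
    _ = _ := by ring

/-- The dropout noise of all layers accumulates to a bounded multiple of its sum. -/
theorem norm_preact_sub_le (hd : 2 ≤ d) (hS : S.Nonempty)
    (hout : ∀ z ∈ S, output d θ z.1 ≠ 0) (hρ : 3 * (d : ℝ) ≤ ρ) (hsm : SmoothFor S θ p ρ w)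
    {z : Vec (h 0) × Vec (h d)} (hz : z ∈ S) {t : ℝ} (ht : t ∈ Set.Icc (0 : ℝ) 1)
    (η : ℕ → ℝ) (hη0 : ∀ m, 0 ≤ η m)
    (hη : ∀ m : Fin (d - 1),
      ‖Matrix.toEuclideanLin (scaleColumns (θ (m + 1)) fun j => multiplier p (w m j) - 1)
        (relu (preact (onSegment θ (dropUpTo p w θ (m + 1)) t) z.1 (m + 1)))‖ ≤
      η m * (frob (θ (m + 1)) *
        ‖relu (preact (onSegment θ (dropUpTo p w θ (m + 1)) t) z.1 (m + 1))‖))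
    (m : ℕ) (hm : m + 1 ≤ d) {j : ℕ} (hmj : m + 1 ≤ j) (hjd : j ≤ d) :
    ‖preact (onSegment θ (dropUpTo p w θ (m + 1)) t) z.1 j - preact θ z.1 j‖ ≤
      (2 * ∑ i ∈ Finset.range m, activationContraction S θ / minCushion S θ * η i) *
        Real.exp ((2 * ∑ i ∈ Finset.range m, activationContraction S θ / minCushion S θ * η i) +
          m / d) * ‖preact θ z.1 j‖ := by
  have hμ0 := minCushion_pos (θ := θ) hd hS hout
  have hc0 := activationContraction_pos (θ := θ) hd hS hout
  induction m generalizing j with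
  | zero =>
    rw [dropUpTo_one]
    simp [onSegment]
  | succ m ih =>
    set α := activationContraction S θ / minCushion S θ * η m with hα
    have hα0 : 0 ≤ α := mul_nonneg (by positivity) (hη0 m)
    have hA0 : 0 ≤ ∑ i ∈ Finset.range m, activationContraction S θ / minCushion S θ * η i :=
      Finset.sum_nonneg fun i _ => mul_nonneg (by positivity) (hη0 i)
    refine (norm_preact_sub_le_step hd hS hout hρ hsm hz ht ⟨m, by omega⟩ (hη0 m)
      (by positivity) (hη ⟨m, by omega⟩) (fun j h1 h2 => ih (by omega) h1 h2) hmj hjd).trans ?_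
    rw [Finset.sum_range_succ, ← hα]
    set A := ∑ i ∈ Finset.range m, activationContraction S θ / minCushion S θ * η i
    refine mul_le_mul_of_nonneg_right ?_ (norm_nonneg _)
    -- The exponent of the bound grows by exactly what is needed to absorb the factor 1 + 2α + 1/d.
    have h1 : Real.exp (2 * (A + α) + ((m + 1 : ℕ) : ℝ) / d) =
        Real.exp (2 * A + m / d) * Real.exp (2 * α + 1 / d) := by
      rw [← Real.exp_add]
      congr 1
      push_cast
      ring
    have h2 : 2 * α + 1 / d + 1 ≤ Real.exp (2 * α + 1 / d) := Real.add_one_le_exp _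
    have h3 : 1 ≤ Real.exp (2 * (A + α) + ((m + 1 : ℕ) : ℝ) / d) := Real.one_le_exp (by positivity)
    calc 2 * A * Real.exp (2 * A + m / d) * (1 + 2 * α + 1 / d) + 2 * α
        ≤ 2 * A * Real.exp (2 * A + m / d) * Real.exp (2 * α + 1 / d) +
          2 * α * Real.exp (2 * (A + α) + ((m + 1 : ℕ) : ℝ) / d) := by
          refine add_le_add (mul_le_mul_of_nonneg_left (by linarith) (by positivity)) ?_
          exact le_mul_of_one_le_right (by positivity) h3
      _ = _ := by rw [h1]; ring

end Propagation

end ReluNet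

namespace ReluNet

/-! ### Continuity along the segment -/

section Lipschitz

variable {d : ℕ} {h : ℕ → ℕ} {p : ℝ} {w : Mask d h} {θ : Params h}

theorem norm_dropUpTo_sub_le (hp0 : 0 < p) (hp1 : p ≤ 3 / 4) (n i : ℕ) :
    ‖dropUpTo p w θ n i - θ i‖ ≤ ‖θ i‖ * 3 := by
  have hz : ∀ A : Matrix (Fin (h (i + 1))) (Fin (h i)) ℝ, A = θ i → ‖A - θ i‖ ≤ ‖θ i‖ * 3 := by
    rintro A rfl
    rw [sub_self, norm_zero]
    positivity
  cases i with
  | zero => exact hz _ rfl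
  | succ i =>
    rcases lt_or_ge i (d - 1) with hi | hi
    · rcases le_or_gt (i + 2) n with hn | hn
      · have : dropUpTo p w θ n (i + 1) - θ (i + 1) =
            scaleColumns (θ (i + 1)) fun j => multiplier p (w ⟨i, hi⟩ j) - 1 := by
          ext r j
          simp [dropUpTo, scaleColumns, sub_mul, hi, hn]
        rw [this]
        exact norm_scaleColumns_le _ _ (by norm_num) fun j => abs_multiplier_sub_one_le hp0 hp1 _
      · exact hz _ (dropUpTo_of_le (by omega))
    · exact hz _ (by simp [dropUpTo, not_lt.2 hi])

theorem norm_onSegment_le (hp0 : 0 < p) (hp1 : p ≤ 3 / 4) {t : ℝ} (ht : t ∈ Set.Icc (0 : ℝ) 1)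
    (n i : ℕ) : ‖onSegment θ (dropUpTo p w θ n) t i‖ ≤ 4 * ‖θ i‖ := by
  rw [onSegment_apply]
  refine (norm_add_le _ _).trans ?_
  rw [norm_smul, Real.norm_eq_abs, abs_of_nonneg ht.1]
  have := norm_dropUpTo_sub_le (w := w) (θ := θ) hp0 hp1 n i
  have := mul_le_of_le_one_left (norm_nonneg (dropUpTo p w θ n i - θ i)) ht.2
  linarith

theorem norm_onSegment_sub_le (hp0 : 0 < p) (hp1 : p ≤ 3 / 4) (t s : ℝ) (n i : ℕ) :
    ‖onSegment θ (dropUpTo p w θ n) t i - onSegment θ (dropUpTo p w θ n) s i‖ ≤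
      |t - s| * (4 * ‖θ i‖) := by
  rw [onSegment_apply, onSegment_apply, add_sub_add_left_eq_sub, ← sub_smul, norm_smul,
    Real.norm_eq_abs]
  have := norm_dropUpTo_sub_le (w := w) (θ := θ) hp0 hp1 n i
  have := norm_nonneg (θ i)
  gcongr
  linarith

theorem norm_preact_onSegment_le (hp0 : 0 < p) (hp1 : p ≤ 3 / 4) {t : ℝ}
    (ht : t ∈ Set.Icc (0 : ℝ) 1) {G : ℝ} (x : Vec (h 0)) (n : ℕ) {j : ℕ}
    (hG : ∀ i < j, 4 * ‖θ i‖ ≤ G) :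
    ‖preact (onSegment θ (dropUpTo p w θ n) t) x j‖ ≤ G ^ j * ‖x‖ := by
  induction j with
  | zero => simp [preact]
  | succ j ih =>
    have ih := ih fun i hi => hG i (by omega)
    rw [preact, step]
    refine (norm_toEuclideanLin_le _ _).trans ?_
    have hGj := hG j (by omega)
    have hG0 : 0 ≤ G := le_trans (by positivity) hGj
    calc _ ≤ G * (G ^ j * ‖x‖) := by
          gcongr
          · exact (norm_onSegment_le hp0 hp1 ht _ _).trans hGj
          · exact (norm_act_le _ _).trans ih
      _ = _ := by ring

/-- Telescoping over the layers. The constant is exponential in j, which is harmless: grid size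
enters the union bound only through its logarithm. -/
theorem norm_preact_onSegment_sub_le (hp0 : 0 < p) (hp1 : p ≤ 3 / 4) {t s : ℝ}
    (ht : t ∈ Set.Icc (0 : ℝ) 1) (hs : s ∈ Set.Icc (0 : ℝ) 1) {G : ℝ} (x : Vec (h 0)) (n : ℕ)
    {j : ℕ} (hG : ∀ i < j, 4 * ‖θ i‖ ≤ G) :
    ‖preact (onSegment θ (dropUpTo p w θ n) t) x j -
        preact (onSegment θ (dropUpTo p w θ n) s) x j‖ ≤ j * G ^ j * ‖x‖ * |t - s| := by
  induction j with
  | zero => simp [preact]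
  | succ j ih =>
    have ih := ih fun i hi => hG i (by omega)
    have hGj := hG j (by omega)
    have hG0 : 0 ≤ G := le_trans (by positivity) hGj
    have hb := norm_preact_onSegment_le (w := w) hp0 hp1 hs x n (j := j) fun i hi => hG i (by omega)
    rw [preact, preact, step, step]
    set P := onSegment θ (dropUpTo p w θ n)
    set u := preact (P t) x j
    set v := preact (P s) x j
    have hsplit : Matrix.toEuclideanLin (P t j) (act j u) - Matrix.toEuclideanLin (P s j) (act j v) =
        Matrix.toEuclideanLin (P t j) (act j u - act j v) +
          Matrix.toEuclideanLin (P t j - P s j) (act j v) := by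
      rw [map_sub, map_sub, LinearMap.sub_apply]
      abel
    rw [hsplit]
    calc _ ≤ G * (j * G ^ j * ‖x‖ * |t - s|) + |t - s| * G * (G ^ j * ‖x‖) := by
          refine (norm_add_le _ _).trans (add_le_add ((norm_toEuclideanLin_le _ _).trans ?_)
            ((norm_toEuclideanLin_le _ _).trans ?_))
          · gcongr
            · exact (norm_onSegment_le hp0 hp1 ht _ _).trans hGj
            · exact (norm_act_sub_le _ _ _).trans ih
          · gcongr
            · exact (norm_onSegment_sub_le hp0 hp1 _ _ _ _).trans (by gcongr)
            · exact (norm_act_le _ _).trans hb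
      _ = _ := by push_cast; ring

end Lipschitz

/-! ### Concentration of the dropout noise -/

/-- The typical relative size of the dropout noise of one layer. -/
noncomputable def noiseScale (K p H : ℝ) : ℝ := (5 * K ^ 2 + 4 * K) * √p / √H

/-- The two terms of `noiseScale` match the two needs of `sum_bitWeight_mul_exp_norm_le`: 5K² makes
each normalized vector at most 2/9, and 4K makes the variance term 12p ∑‖v j‖² at most 1. -/
theorem sum_exp_noise_le {m n : ℕ} (A : Matrix (Fin m) (Fin n) ℝ) (y : Vec n) {K p H : ℝ}
    (hK : 0 < K) (hp0 : 0 < p) (hp1 : p ≤ 3 / 4) (hH0 : 0 < H) (hHn : H ≤ n)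
    (hA : ∀ j, ‖column A j‖ ≤ K * √p * frob A) (hy : ∀ j, |y j| ≤ K / √n * ‖y‖) :
    ∑ b : Fin n → Bool, (∏ j, bitWeight p (b j)) *
      Real.exp (‖Matrix.toEuclideanLin (scaleColumns A fun j => multiplier p (b j) - 1) y‖ /
        (noiseScale K p H * (frob A * ‖y‖))) ≤ Real.exp 2 := by
  have hF := frob_nonneg A
  have hsp : 0 < √p := Real.sqrt_pos.2 hp0
  have hsH : 0 < √H := Real.sqrt_pos.2 hH0
  have hn0 : (0 : ℝ) < n := hH0.trans_le hHn
  have hsn : 0 < √(n : ℝ) := Real.sqrt_pos.2 hn0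
  have hc0 : 0 < noiseScale K p H := by unfold noiseScale; positivity
  -- If ‖A‖_F ‖y‖ = 0, division by zero returns 0 and the exponential is 1.
  rcases (mul_nonneg hF (norm_nonneg y)).eq_or_lt' with h0 | h0
  · simp only [h0, mul_zero, div_zero, Real.exp_zero, mul_one]
    rw [sum_prod_eq_one (fun _ => bitWeight p) fun _ => sum_bitWeight p]
    exact Real.one_le_exp (by norm_num)
  set c := noiseScale K p H with hc
  set D := c * (frob A * ‖y‖) with hD
  have hD0 : 0 < D := by positivity
  let v : Fin n → Vec m := fun j => D⁻¹ • y j • column A j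
  have hvn : ∀ j, ‖v j‖ = |y j| * ‖column A j‖ / D := fun j => by
    simp only [v, norm_smul, Real.norm_eq_abs, abs_of_pos (inv_pos.2 hD0)]
    field_simp
  have hcH : K / √n * √p * (5 * K + 4) ≤ c := by
    calc K / √n * √p * (5 * K + 4) ≤ K / √H * √p * (5 * K + 4) := by gcongr
      _ = c := by rw [hc, noiseScale]; ring
  have hv : ∀ j, ‖v j‖ ≤ 2 / 9 := fun j => by
    rw [hvn, div_le_iff₀ hD0]
    calc |y j| * ‖column A j‖ ≤ (K / √n * ‖y‖) * (K * √p * frob A) := by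
          gcongr
          · exact hy j
          · exact hA j
      _ = (1 / 5) * ((K / √n * √p * (5 * K)) * (frob A * ‖y‖)) := by ring
      _ ≤ (2 / 9) * ((K / √n * √p * (5 * K + 4)) * (frob A * ‖y‖)) := by
          refine mul_le_mul (by norm_num) ?_ (by positivity) (by norm_num)
          gcongr
          linarith
      _ ≤ 2 / 9 * D := by rw [hD]; gcongr
  have hsum : 12 * p * ∑ j, ‖v j‖ ^ 2 ≤ 1 := by
    have h1 : ∑ j, ‖v j‖ ^ 2 ≤ (K / √n * ‖y‖) ^ 2 * frob A ^ 2 / D ^ 2 := by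
      rw [frob_sq, Finset.mul_sum, Finset.sum_div]
      refine Finset.sum_le_sum fun j _ => ?_
      rw [hvn, div_pow, mul_pow]
      gcongr
      exact hy j
    have h2 : (K / √n * √p) ^ 2 * 16 ≤ c ^ 2 := by
      calc (K / √n * √p) ^ 2 * 16 = (K / √n * √p * 4) ^ 2 := by ring
        _ ≤ (K / √n * √p * (5 * K + 4)) ^ 2 := by gcongr; linarith
        _ ≤ c ^ 2 := by gcongr
    calc 12 * p * ∑ j, ‖v j‖ ^ 2 ≤ 12 * p * ((K / √n * ‖y‖) ^ 2 * frob A ^ 2 / D ^ 2) := by gcongr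
      _ = 12 * ((K / √n * √p) ^ 2 * (frob A * ‖y‖) ^ 2) / (c ^ 2 * (frob A * ‖y‖) ^ 2) := by
          rw [hD]
          have := Real.sq_sqrt hp0.le
          simp only [mul_pow, this]
          ring
      _ = 12 * (K / √n * √p) ^ 2 / c ^ 2 := by
          rw [← mul_assoc, mul_div_mul_right _ _ (by positivity)]
      _ ≤ 1 := by
          rw [div_le_one (by positivity)]
          nlinarith [sq_nonneg (K / √n * √p)]
  have hnorm : ∀ b : Fin n → Bool,
      ‖Matrix.toEuclideanLin (scaleColumns A fun j => multiplier p (b j) - 1) y‖ / D =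
        ‖∑ j, (multiplier p (b j) - 1) • v j‖ := fun b => by
    have : ∑ j, (multiplier p (b j) - 1) • v j =
        D⁻¹ • Matrix.toEuclideanLin (scaleColumns A fun j => multiplier p (b j) - 1) y := by
      rw [toEuclideanLin_scaleColumns, Finset.smul_sum]
      exact Finset.sum_congr rfl fun j _ => smul_comm _ _ _
    rw [this, norm_smul, Real.norm_eq_abs, abs_of_pos (inv_pos.2 hD0)]
    field_simp
  simp only [hnorm]
  exact (sum_bitWeight_mul_exp_norm_le hp0 hp1 v hv).trans (Real.exp_le_exp.2 (by linarith))

open Classical in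
/-- The normalized noise that the dropout of layer `m + 2` causes at parameter `t` of the segment,
as long as the activations feeding that layer are spread out. -/
noncomputable def layerNoise {d : ℕ} {h : ℕ → ℕ} (θ : Params h) (K p H t : ℝ) (x : Vec (h 0)) (m : Fin (d - 1))
    (w : Mask d h) : ℝ :=
  let y := relu (preact (onSegment θ (dropUpTo p w θ (m + 1)) t) x (m + 1))
  if ∀ j, |y j| ≤ K / √(h (m + 1)) * ‖y‖ then
    ‖Matrix.toEuclideanLin (scaleColumns (θ (m + 1)) fun j => multiplier p (w m j) - 1) y‖ /
      (noiseScale K p H * (frob (θ (m + 1)) * ‖y‖))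
  else 0

section Concentration

variable {d : ℕ} {h : ℕ → ℕ} {θ : Params h} {K p H : ℝ}

theorem noiseScale_nonneg (hK : 0 < K) : 0 ≤ noiseScale K p H := by
  unfold noiseScale; positivity

theorem layerNoise_nonneg (hK : 0 < K) (t : ℝ) (x : Vec (h 0)) (m : Fin (d - 1)) (w : Mask d h) :
    0 ≤ layerNoise θ K p H t x m w := by
  have := noiseScale_nonneg (p := p) (H := H) hK
  have := frob_nonneg (θ (m + 1))
  unfold layerNoise
  dsimp only
  split_ifs
  · positivity
  · exact le_rfl

/-- Given the earlier masks, the input of a layer is fixed. Either it is spread out and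
`sum_exp_noise_le` applies, or the cut-off makes the noise zero. No conditioning on the good event
occurs. -/
theorem sum_maskWeight_mul_exp_le (hK : 0 < K) (hp0 : 0 < p) (hp1 : p ≤ 3 / 4) (hH0 : 0 < H)
    (hH : ∀ m : Fin (d - 1), H ≤ h (m + 1))
    (hθ : ∀ m : Fin (d - 1), ∀ j, ‖column (θ (m + 1)) j‖ ≤ K * √p * frob (θ (m + 1)))
    (t : ℝ) (x : Vec (h 0)) :
    ∑ w : Mask d h, maskWeight p w * Real.exp (∑ m, layerNoise θ K p H t x m w) ≤
      Real.exp (2 * (d - 1 : ℕ)) := by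
  have hone : ∀ k : Fin (d - 1), ∑ b : Fin (h (k + 1)) → Bool, ∏ j, bitWeight p (b j) = 1 :=
    fun k => sum_prod_eq_one (fun _ => bitWeight p) fun _ => sum_bitWeight _
  have := sum_prod_mul_prod_le
    (fun (k : Fin (d - 1)) (b : Fin (h (k + 1)) → Bool) => ∏ j, bitWeight p (b j))
    (fun k b => Finset.prod_nonneg fun j _ => bitWeight_nonneg hp0.le (by linarith) _) hone
    (fun m w => Real.exp (layerNoise θ K p H t x m w)) (fun m w => (Real.exp_pos _).le)
    (fun i j hij w a => by
      simp only [layerNoise]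
      rw [dropUpTo_update a (by simp only [Fin.lt_def] at hij; omega),
        Function.update_of_ne hij.ne])
    (B := Real.exp 2) (fun i w => by
      unfold layerNoise
      simp only [dropUpTo_update (p := p) (w := w) (θ := θ) (m := i) _ (show (i : ℕ) + 1 < i + 2 by omega),
        Function.update_self]
      split_ifs with hy
      · exact sum_exp_noise_le _ _ hK hp0 hp1 hH0 (hH i) (hθ i) hy
      · simp only [Real.exp_zero, mul_one]
        rw [hone]
        exact Real.one_le_exp (by norm_num)) (Real.exp_pos _).le
  simp only [Real.exp_sum, maskWeight]
  refine this.trans_eq ?_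
  rw [← Real.exp_nat_mul]
  congr 1
  ring

theorem dropoutLaw_real_noise_le (hK : 0 < K) (hp0 : 0 < p) (hp1 : p ≤ 3 / 4) (hH0 : 0 < H)
    (hH : ∀ m : Fin (d - 1), H ≤ h (m + 1))
    (hθ : ∀ m : Fin (d - 1), ∀ j, ‖column (θ (m + 1)) j‖ ≤ K * √p * frob (θ (m + 1)))
    (t : ℝ) (x : Vec (h 0)) (T : ℝ) :
    (dropoutLaw d h p).real {w | T < ∑ m, layerNoise θ K p H t x m w} ≤
      Real.exp (2 * (d - 1 : ℕ) - T) := by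
  refine (dropoutLaw_real_le hp0.le (by linarith) _
    (fun w => Real.exp (∑ m, layerNoise θ K p H t x m w) * Real.exp (-T))
    (fun w => by positivity) fun w hw => ?_).trans ?_
  · rw [← Real.exp_add]
    exact Real.one_le_exp (by linarith)
  · simp_rw [← mul_assoc]
    rw [← Finset.sum_mul, sub_eq_add_neg, Real.exp_add]
    have := sum_maskWeight_mul_exp_le hK hp0 hp1 hH0 hH hθ t x
    gcongr

theorem norm_noise_le {S : Sample d h} {w : Mask d h} (hK : 0 < K) (hp0 : 0 < p) (hH0 : 0 < H)
    (hspread : SpreadFor S θ p K w) {z : Vec (h 0) × Vec (h d)} (hz : z ∈ S) {t : ℝ}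
    (ht : t ∈ Set.Icc (0 : ℝ) 1) (m : Fin (d - 1)) :
    ‖Matrix.toEuclideanLin (scaleColumns (θ (m + 1)) fun j => multiplier p (w m j) - 1)
        (relu (preact (onSegment θ (dropUpTo p w θ (m + 1)) t) z.1 (m + 1)))‖ ≤
      noiseScale K p H * layerNoise θ K p H t z.1 m w * (frob (θ (m + 1)) *
        ‖relu (preact (onSegment θ (dropUpTo p w θ (m + 1)) t) z.1 (m + 1))‖) := by
  have hc0 : 0 < noiseScale K p H := by
    have := Real.sqrt_pos.2 hp0
    have := Real.sqrt_pos.2 hH0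
    unfold noiseScale; positivity
  have hs := hspread z hz (m + 1) (by omega) (by omega) t ht
  unfold layerNoise
  dsimp only
  rw [if_pos hs]
  set y := relu (preact (onSegment θ (dropUpTo p w θ (m + 1)) t) z.1 (m + 1))
  rcases eq_or_ne y 0 with hy | hy
  · simp [hy]
  rcases eq_or_ne (frob (θ (m + 1))) 0 with hF | hF
  · rw [toEuclideanLin_scaleColumns]
    simp [column_eq_zero hF]
  have := norm_pos_iff.2 hy
  refine le_of_eq ?_
  field_simp

end Concentration

end ReluNet

namespace ReluNet

/-! ### Quantities dominated by the exponential of the logarithmic factor -/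

section LogFactor

variable {d : ℕ} {h : ℕ → ℕ} (S : Sample d h) (θ : Params h) {β ε : ℝ}

theorem maxInput_nonneg : 0 ≤ maxInput S := Real.iSup_nonneg fun _ => norm_nonneg _

theorem maxOutput_nonneg : 0 ≤ maxOutput S θ := Real.iSup_nonneg fun _ => norm_nonneg _

theorem exp_logFactor (hβε : 0 ≤ β / ε) :
    Real.exp (logFactor S θ β ε) = 3 + (S.card : ℝ) + (d : ℝ) + maxInput S + β / ε +
      ∑ i ∈ Finset.range d, ((h (i + 1) : ℝ) + ‖θ i‖) := by
  have := maxInput_nonneg S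
  have : 0 ≤ ∑ i ∈ Finset.range d, ((h (i + 1) : ℝ) + ‖θ i‖) :=
    Finset.sum_nonneg fun i _ => by positivity
  exact Real.exp_log (by positivity)

theorem add_le_exp_logFactor (hβε : 0 ≤ β / ε) :
    3 + (S.card : ℝ) + (d : ℝ) + maxInput S + β / ε ≤ Real.exp (logFactor S θ β ε) := by
  rw [exp_logFactor S θ hβε, le_add_iff_nonneg_right]
  exact Finset.sum_nonneg fun i _ => by positivity

theorem width_add_norm_le_exp_logFactor (hβε : 0 ≤ β / ε) {i : ℕ} (hi : i < d) :
    (h (i + 1) : ℝ) + ‖θ i‖ ≤ Real.exp (logFactor S θ β ε) := by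
  rw [exp_logFactor S θ hβε]
  have h1 := Finset.single_le_sum (f := fun i => (h (i + 1) : ℝ) + ‖θ i‖)
    (fun i _ => by positivity) (Finset.mem_range.2 hi)
  have := maxInput_nonneg S
  refine h1.trans (le_add_of_nonneg_left (by positivity))

theorem one_le_logFactor (hβε : 0 ≤ β / ε) : 1 ≤ logFactor S θ β ε := by
  have h1 := add_le_exp_logFactor S θ hβε
  have := maxInput_nonneg S
  have h2 : 3 ≤ Real.exp (logFactor S θ β ε) := by
    have h3 : (0 : ℝ) ≤ S.card := by positivity
    have h4 : (0 : ℝ) ≤ d := by positivity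
    linarith
  rw [← Real.exp_le_exp]
  exact Real.exp_one_lt_three.le.trans h2

end LogFactor

/-! ### From loss bounds to dropout stability -/

theorem minWidth_le {d : ℕ} {h : ℕ → ℕ} (m : Fin (d - 1)) : minWidth d h ≤ h (m + 1) :=
  ciInf_le (OrderBot.bddBelow _) m

theorem loss_le_add {d : ℕ} {h : ℕ → ℕ} {l : Vec (h d) → Vec (h d) → ℝ} {S : Sample d h}
    {θ θ' : Params h} {b : ℝ} (hS : S.Nonempty)
    (hl : ∀ z ∈ S, l z.2 (output d θ' z.1) ≤ l z.2 (output d θ z.1) + b) :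
    loss l S θ' ≤ loss l S θ + b := by
  have hc : (0 : ℝ) < S.card := by exact_mod_cast hS.card_pos
  unfold loss
  calc _ ≤ 1 / (S.card : ℝ) * ∑ z ∈ S, (l z.2 (output d θ z.1) + b) := by
        gcongr with z hz
        exact hl z hz
    _ = _ := by
        rw [Finset.sum_add_distrib, Finset.sum_const, nsmul_eq_mul]
        field_simp

/-- Dropout of all layers with `p = 3 / 4` keeps at most half of the units with high
probability. -/
theorem isDropoutStable_of_prob {d : ℕ} {h : ℕ → ℕ} {l : Vec (h d) → Vec (h d) → ℝ}
    {S : Sample d h} {θ : Params h} {η L : ℝ}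
    (hdL : 3 + (d : ℝ) ≤ Real.exp L) (hH : 16 * L ≤ minWidth d h)
    (hP : 1 / 4 ≤ (dropoutLaw d h (3 / 4)).real
      {w | loss l S (dropUpTo (3 / 4) w θ d) ≤ loss l S θ + η}) :
    IsDropoutStable l S θ η := by
  classical
  have := isProbabilityMeasure_dropoutLaw d h (p := 3 / 4) (by norm_num) (by norm_num)
  set kept : Mask d h → (i : Fin (d - 1)) → Finset (Fin (h (i + 1))) :=
    fun w i => Finset.univ.filter fun j => w i j = true
  have hbad : (dropoutLaw d h (3 / 4)).real
      (⋃ i ∈ (Finset.univ : Finset (Fin (d - 1))), {w | h (i + 1) / 2 < (kept w i).card}) < 1 / 4 := by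
    refine (measureReal_biUnion_finset_le _ _).trans_lt ?_
    -- Width at least 16L turns exp(-h/8) into exp(-2L) ≤ (3 + d)⁻², which beats the number of
    -- layers.
    calc _ ≤ ∑ i : Fin (d - 1), Real.exp (-(2 * L)) := by
          refine Finset.sum_le_sum fun i _ => (dropoutLaw_real_kept_le i).trans ?_
          have : (minWidth d h : ℝ) ≤ h (i + 1) := by exact_mod_cast minWidth_le i
          exact Real.exp_le_exp.2 (by linarith)
      _ = (d - 1 : ℕ) * (1 / (Real.exp L * Real.exp L)) := by
          rw [Finset.sum_const, Finset.card_univ, Fintype.card_fin, nsmul_eq_mul, Real.exp_neg,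
            two_mul, Real.exp_add, one_div]
      _ ≤ d * (1 / (Real.exp L * Real.exp L)) := by
          gcongr
          omega
      _ < 1 / 4 := by
          rw [mul_one_div, div_lt_div_iff₀ (by positivity) (by norm_num)]
          have h0 : (0 : ℝ) ≤ d := by positivity
          nlinarith
  have hex : ∃ w, loss l S (dropUpTo (3 / 4) w θ d) ≤ loss l S θ + η ∧
      ∀ i, (kept w i).card ≤ h (i + 1) / 2 := by
    by_contra hcon
    push Not at hcon
    refine absurd (hP.trans (measureReal_mono (fun w hw => ?_) (measure_ne_top _ _))) (not_le.2 hbad)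
    obtain ⟨i, hi⟩ := hcon w hw
    simp only [Set.mem_iUnion]
    exact ⟨i, Finset.mem_univ i, hi⟩
  obtain ⟨w, hw, hk⟩ := hex
  let U : (i : ℕ) → Finset (Fin (h i))
    | 0 => ∅
    | i + 1 => if hi : i < d - 1 then kept w ⟨i, hi⟩ else ∅
  -- The common factor is 1/(1 - p) = 4.
  refine ⟨4, U, dropUpTo (3 / 4) w θ d, fun i hi1 hid => ?_, rfl, fun i hi1 hid => ?_, hw⟩
  · obtain ⟨i, rfl⟩ := Nat.exists_eq_add_of_le' hi1
    simp only [U]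
    rw [dif_pos (by omega)]
    exact hk ⟨i, by omega⟩
  · obtain ⟨i, rfl⟩ := Nat.exists_eq_add_of_le' hi1
    have hi : i < d - 1 := by omega
    simp only [U, dropUpTo, hi, dif_pos, show i + 2 ≤ d by omega, if_true]
    congr 1
    funext j
    simp only [kept, Finset.mem_filter, Finset.mem_univ, true_and, multiplier]
    norm_num

/-! ### Union bound over a grid and assembly of the estimates -/

section Main

variable {d : ℕ} {h : ℕ → ℕ} {S : Sample d h} {θ : Params h} {K p H : ℝ}

/-- With high probability the accumulated noise is small for all inputs and on a whole grid of
points of the segment. -/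
theorem dropoutLaw_real_grid_le (hd : 2 ≤ d) (hK : 0 < K) (hp0 : 0 < p) (hp1 : p ≤ 3 / 4)
    (hH0 : 0 < H) (hH : ∀ m : Fin (d - 1), H ≤ h (m + 1))
    (hθ : ∀ m : Fin (d - 1), ∀ j, ‖column (θ (m + 1)) j‖ ≤ K * √p * frob (θ (m + 1)))
    {L : ℝ} (hL : 1 ≤ L) (hS : (S.card : ℝ) ≤ Real.exp L) {N : ℕ}
    (hN : (N : ℝ) + 1 ≤ Real.exp (4 * d * L + 3 * L)) :
    (dropoutLaw d h p).real {w | ∃ z ∈ S, ∃ k ≤ N,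
      12 * d * L < ∑ m, layerNoise θ K p H ((k : ℝ) / N) z.1 m w} ≤ 1 / 4 := by
  classical
  have := isProbabilityMeasure_dropoutLaw d h hp0.le (by linarith : p ≤ 1)
  have hset : {w : Mask d h | ∃ z ∈ S, ∃ k ≤ N,
      12 * d * L < ∑ m, layerNoise θ K p H ((k : ℝ) / N) z.1 m w} =
      ⋃ a ∈ S ×ˢ Finset.range (N + 1),
        {w : Mask d h | 12 * d * L < ∑ m, layerNoise θ K p H ((a.2 : ℝ) / N) a.1.1 m w} := by
    ext w
    simp only [Set.mem_ofPred_eq, Set.mem_iUnion, Finset.mem_product, Finset.mem_range, exists_prop,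
      Prod.exists]
    constructor
    · rintro ⟨z1, z2, hz, k, hk, hw⟩
      exact ⟨z1, z2, k, ⟨hz, by omega⟩, hw⟩
    · rintro ⟨z1, z2, k, ⟨hz, hk⟩, hw⟩
      exact ⟨z1, z2, hz, k, by omega, hw⟩
  rw [hset]
  refine (measureReal_biUnion_finset_le _ _).trans ?_
  have hd2 : (2 : ℝ) ≤ d := by exact_mod_cast hd
  have hd1 : ((d - 1 : ℕ) : ℝ) ≤ d := by exact_mod_cast Nat.sub_le d 1
  -- The level 12dL pays for the moment bound 2d, the inputs L and the grid 4dL + 3L, leaving an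
  -- exponent below -3 since d ≥ 2 and L ≥ 1.
  calc _ ≤ ∑ a ∈ S ×ˢ Finset.range (N + 1), Real.exp (2 * d - 12 * d * L) := by
        refine Finset.sum_le_sum fun a _ =>
          (dropoutLaw_real_noise_le hK hp0 hp1 hH0 hH hθ _ _ _).trans (Real.exp_le_exp.2 ?_)
        linarith
    _ = S.card * ((N : ℝ) + 1) * Real.exp (2 * d - 12 * d * L) := by
        rw [Finset.sum_const, Finset.card_product, Finset.card_range, nsmul_eq_mul]
        push_cast
        ring
    _ ≤ Real.exp L * Real.exp (4 * d * L + 3 * L) * Real.exp (2 * d - 12 * d * L) := by gcongr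
    _ = Real.exp (4 * L + 2 * d - 8 * d * L) := by
        rw [← Real.exp_add, ← Real.exp_add]
        congr 1
        ring
    _ ≤ Real.exp (-3) := Real.exp_le_exp.2 (by nlinarith)
    _ ≤ 1 / 4 := by
        rw [Real.exp_neg, ← one_div]
        refine one_div_le_one_div_of_le (by norm_num) ?_
        have := Real.add_one_le_exp (3 : ℝ)
        linarith

/-- Points of the grid: small accumulated noise bounds the change of the output. -/
theorem norm_output_sub_le (hd : 2 ≤ d) (hS : S.Nonempty) (hout : ∀ z ∈ S, output d θ z.1 ≠ 0)
    (hK : 0 < K) (hp0 : 0 < p) (hH0 : 0 < H) {ρ : ℝ} (hρ : 3 * (d : ℝ) ≤ ρ) {w : Mask d h}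
    (hsm : SmoothFor S θ p ρ w) (hspread : SpreadFor S θ p K w)
    {z : Vec (h 0) × Vec (h d)} (hz : z ∈ S) {t : ℝ} (ht : t ∈ Set.Icc (0 : ℝ) 1) {T A : ℝ}
    (hT : ∑ m, layerNoise θ K p H t z.1 m w ≤ T)
    (hA : activationContraction S θ / minCushion S θ * (noiseScale K p H * T) ≤ A) :
    ‖output d (onSegment θ (dropUpTo p w θ d) t) z.1 - output d θ z.1‖ ≤
      2 * A * Real.exp (2 * A + 1) * ‖output d θ z.1‖ := by
  have hμ0 := minCushion_pos (θ := θ) hd hS hout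
  have hc0 := activationContraction_pos (θ := θ) hd hS hout
  have hs0 := noiseScale_nonneg (p := p) (H := H) hK
  set η : ℕ → ℝ := fun m => if hm : m < d - 1 then
    noiseScale K p H * layerNoise θ K p H t z.1 ⟨m, hm⟩ w else 0 with hη
  have hη0 : ∀ m, 0 ≤ η m := fun m => by
    simp only [hη]
    split_ifs with hm
    · exact mul_nonneg hs0 (layerNoise_nonneg hK _ _ _ _)
    · exact le_rfl
  have hηm : ∀ m : Fin (d - 1), η m = noiseScale K p H * layerNoise θ K p H t z.1 m w :=
    fun m => by simp [hη]
  have hsum : ∑ i ∈ Finset.range (d - 1), activationContraction S θ / minCushion S θ * η i ≤ A := by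
    rw [← Finset.mul_sum, Finset.sum_range]
    simp only [hηm]
    rw [← Finset.mul_sum]
    refine le_trans ?_ hA
    gcongr
  have hsum0 : 0 ≤ ∑ i ∈ Finset.range (d - 1),
      activationContraction S θ / minCushion S θ * η i :=
    Finset.sum_nonneg fun i _ => mul_nonneg (by positivity) (hη0 i)
  have key := norm_preact_sub_le hd hS hout hρ hsm hz ht η hη0 (fun m => by
    rw [hηm]
    exact norm_noise_le hK hp0 hH0 hspread hz ht m) (d - 1) (by omega) (j := d) (by omega) le_rfl
  rw [Nat.sub_add_cancel (by omega : 1 ≤ d)] at key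
  refine key.trans ?_
  have hd1 : ((d - 1 : ℕ) : ℝ) / d ≤ 1 :=
    div_le_one_of_le₀ (by exact_mod_cast Nat.sub_le d 1) (by positivity)
  have hA0 : 0 ≤ A := hsum0.trans hsum
  unfold output
  gcongr

end Main

theorem exists_grid_point {N : ℕ} (hN : 0 < N) {t : ℝ} (ht : t ∈ Set.Icc (0 : ℝ) 1) :
    ∃ k ≤ N, (k : ℝ) / N ∈ Set.Icc (0 : ℝ) 1 ∧ |t - (k : ℝ) / N| ≤ 1 / N := by
  have hN' : (0 : ℝ) < N := by exact_mod_cast hN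
  have h1 := Nat.floor_le (mul_nonneg ht.1 hN'.le)
  have h2 := Nat.lt_floor_add_one (t * N)
  have hk : (⌊t * N⌋₊ : ℝ) ≤ N := h1.trans (mul_le_of_le_one_left hN'.le ht.2)
  refine ⟨⌊t * N⌋₊, by exact_mod_cast hk, ⟨by positivity, div_le_one_of_le₀ hk hN'.le⟩, ?_⟩
  have h3 : t - (⌊t * N⌋₊ : ℝ) / N = (t * N - ⌊t * N⌋₊) / N := by field_simp
  rw [h3, abs_div, abs_of_pos hN']
  gcongr
  rw [abs_le]
  constructor <;> linarith

/-- Neighbouring grid points of the segment have almost the same output. -/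
theorem mul_norm_output_sub_le {d : ℕ} {h : ℕ → ℕ} {θ : Params h} {β p ε L : ℝ} {w : Mask d h}
    (hd : 2 ≤ d) (hβ : 0 < β) (hε : 0 < ε) (hp0 : 0 < p) (hp1 : p ≤ 3 / 4) (hL1 : 1 ≤ L)
    (hdL : 3 + (d : ℝ) ≤ Real.exp L) (hθ : ∀ i < d, ‖θ i‖ ≤ Real.exp L) {x : Vec (h 0)}
    (hx : ‖x‖ ≤ Real.exp L) (hβε : β / ε ≤ Real.exp L) (hsp : Real.exp (-L) ≤ √p) {N : ℝ}
    (hN : Real.exp (4 * d * L + 2 * L) ≤ N) {t s : ℝ} (ht : t ∈ Set.Icc (0 : ℝ) 1)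
    (hs : s ∈ Set.Icc (0 : ℝ) 1) (hts : |t - s| ≤ 1 / N) :
    β * ‖output d (onSegment θ (dropUpTo p w θ d) t) x -
      output d (onSegment θ (dropUpTo p w θ d) s) x‖ ≤ √p * ε * L := by
  have hd2 : (2 : ℝ) ≤ d := by exact_mod_cast hd
  have h1 := norm_preact_onSegment_sub_le (w := w) (θ := θ) hp0 hp1 ht hs (G := 4 * Real.exp L) x d
    (j := d) fun i hi => mul_le_mul_of_nonneg_left (hθ i hi) (by norm_num)
  have h4 : 4 * Real.exp L ≤ Real.exp (3 * L) := by
    have : Real.exp (3 * L) = Real.exp L * Real.exp L * Real.exp L := by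
      rw [← Real.exp_add, ← Real.exp_add]
      congr 1
      ring
    rw [this]
    have h3 : 3 ≤ Real.exp L := by linarith
    gcongr
    nlinarith
  have h5 : β ≤ ε * Real.exp L := (div_le_iff₀' hε).1 hβε
  unfold output
  -- The mesh exp(-4dL - 2L) cancels d, ‖x‖ and the power of the weights. What remains is ε exp(L -
  -- dL), at most ε exp(-L) because d ≥ 2, and √p ≥ exp(-L).
  calc _ ≤ β * (d * (4 * Real.exp L) ^ d * ‖x‖ * |t - s|) := by gcongr
    _ ≤ (ε * Real.exp L) * (Real.exp L * Real.exp (3 * L) ^ d * Real.exp L *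
          (1 / Real.exp (4 * d * L + 2 * L))) := by
        gcongr
        · linarith
        · exact hts.trans (one_div_le_one_div_of_le (Real.exp_pos _) hN)
    _ = ε * Real.exp (L - d * L) := by
        rw [← Real.exp_nat_mul, one_div, ← Real.exp_neg, mul_assoc, ← Real.exp_add,
          ← Real.exp_add, ← Real.exp_add, ← Real.exp_add]
        congr 2
        ring
    _ ≤ ε * Real.exp (-L) := by
        gcongr
        nlinarith
    _ ≤ ε * √p := by gcongr
    _ ≤ ε * √p * L := le_mul_of_one_le_right (by positivity) hL1
    _ = _ := by ring

/-- The accumulated noise in terms of the noise stability parameter. -/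
theorem cushion_mul_noiseScale_le {d : ℕ} {h : ℕ → ℕ} {S : Sample d h} {θ : Params h}
    {K p β L : ℝ} (hK : 0 < K) (hd : 1 ≤ d) (hL : 0 ≤ L) (hβ : 0 < β)
    (hw0 : 0 < (minWidth d h : ℝ)) (hμ0 : 0 < minCushion S θ)
    (hc0 : 0 < activationContraction S θ) (hmax0 : 0 < maxOutput S θ) :
    activationContraction S θ / minCushion S θ *
        (noiseScale K p (minWidth d h) * (12 * d * L)) ≤
      12 * (5 * K ^ 2 + 4 * K) *
        (√p * noiseParameter S θ β * L / (β * maxOutput S θ)) := by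
  have hd1 : (1 : ℝ) ≤ d := by exact_mod_cast hd
  -- The joint moment bound makes the total noise linear in d, so the exponent 3/2 in ε leaves
  -- slack.
  have hdd : (d : ℝ) ≤ (d : ℝ) ^ (3 / 2 : ℝ) := by
    calc (d : ℝ) = (d : ℝ) ^ (1 : ℝ) := (Real.rpow_one _).symm
      _ ≤ _ := Real.rpow_le_rpow_of_exponent_le hd1 (by norm_num)
  have hsH : 0 < √(minWidth d h : ℝ) := Real.sqrt_pos.2 hw0
  have hBeq : √p * noiseParameter S θ β * L / (β * maxOutput S θ) =
      activationContraction S θ / minCushion S θ * (√p / √(minWidth d h)) *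
        (d : ℝ) ^ (3 / 2 : ℝ) * L := by
    rw [noiseParameter]
    field_simp
  calc _ = 12 * (5 * K ^ 2 + 4 * K) * (activationContraction S θ / minCushion S θ *
        (√p / √(minWidth d h)) * d * L) := by
        rw [noiseScale]
        ring
    _ ≤ _ := by
        rw [hBeq]
        gcongr

/-- A relative error that is linear in `B ≤ K` up to a bounded factor. -/
theorem mul_le_of_relative_error {β B K M X F f m : ℝ} (hβ : 0 < β) (hM : 0 < M) (hB0 : 0 ≤ B)
    (hBK : B ≤ K) (hfm : f ≤ m) (hm : 0 ≤ m) (hX : B * (β * m) = X)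
    (hF : F ≤ 2 * (12 * M * B) * Real.exp (2 * (12 * M * B) + 1) * f) :
    β * F ≤ 24 * M * Real.exp (24 * M * K + 1) * X := by
  calc β * F ≤ β * (2 * (12 * M * B) * Real.exp (2 * (12 * M * B) + 1) * m) := by
        gcongr
        exact hF.trans (by gcongr)
    _ = 24 * M * Real.exp (2 * (12 * M * B) + 1) * (B * (β * m)) := by ring
    _ ≤ 24 * M * Real.exp (24 * M * K + 1) * (B * (β * m)) := by
        gcongr ?_ * Real.exp ?_ * _
        nlinarith
    _ = _ := by rw [hX]

/-- The constant of the theorem. -/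
noncomputable def stabilityConstant (K : ℝ) : ℝ :=
  24 * (5 * K ^ 2 + 4 * K) * Real.exp (24 * (5 * K ^ 2 + 4 * K) * K + 1) + 16

theorem prob_loss_le {K : ℝ} (hK : 0 < K) {d : ℕ} {h : ℕ → ℕ}
    {l : Vec (h d) → Vec (h d) → ℝ} {S : Sample d h} {θ : Params h} {β p ε L : ℝ}
    (hd : 2 ≤ d) (hS : S.Nonempty) (hβ : 0 < β) (hε : 0 < ε)
    (hl : ∀ y a b, |l y a - l y b| ≤ β * ‖a - b‖)
    (hout : ∀ z ∈ S, output d θ z.1 ≠ 0) (hεeq : ε = noiseParameter S θ β)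
    (hL : L = logFactor S θ β ε) {ρ : ℝ} (hρ : 3 * (d : ℝ) ≤ ρ)
    (hgood : 1 / 2 ≤ (dropoutLaw d h p).real {w | SmoothFor S θ p ρ w ∧ SpreadFor S θ p K w})
    (hw0 : 0 < (minWidth d h : ℝ)) (hpw : 1 / (minWidth d h : ℝ) ≤ p) (hp1 : p ≤ 3 / 4)
    (hcol : ∀ i, 1 ≤ i → i < d → ∀ j, ‖column (θ i) j‖ ≤ K * √p * frob (θ i))
    (hcond : √p * ε * L ≤ K * (β * maxOutput S θ)) :
    1 / 4 ≤ (dropoutLaw d h p).real {w | ∀ t ∈ Set.Icc (0 : ℝ) 1,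
      loss l S (onSegment θ (dropUpTo p w θ d) t) ≤
        loss l S θ + stabilityConstant K * (√p * ε * L)} := by
  set H : ℝ := (minWidth d h : ℝ) with hHdef
  have hp0 : 0 < p := lt_of_lt_of_le (by positivity) hpw
  have hβε : 0 ≤ β / ε := by positivity
  have hL1 : 1 ≤ L := hL ▸ one_le_logFactor S θ hβε
  have hE := add_le_exp_logFactor S θ hβε
  rw [← hL] at hE
  have hEw : ∀ i < d, (h (i + 1) : ℝ) + ‖θ i‖ ≤ Real.exp L := fun i hi =>
    hL ▸ width_add_norm_le_exp_logFactor S θ hβε hi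
  have hin0 := maxInput_nonneg S
  have hout0 := maxOutput_nonneg S θ
  have hcard0 : (0 : ℝ) ≤ S.card := by positivity
  have hd0 : (0 : ℝ) ≤ d := by positivity
  have hd2 : (2 : ℝ) ≤ d := by exact_mod_cast hd
  have hHm : ∀ m : Fin (d - 1), H ≤ h (m + 1) := fun m => Nat.cast_le.2 (minWidth_le m)
  have hHL : H ≤ Real.exp L := by
    have h1 := hEw 0 (by omega)
    have h2 := hHm ⟨0, by omega⟩
    have h3 := norm_nonneg (θ 0)
    exact h2.trans (le_trans (by linarith) h1)
  -- Here p ≥ 1/h_min ≥ exp(-L), and √p ≥ p because p ≤ 1.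
  have hsp : Real.exp (-L) ≤ √p := by
    have h1 : Real.exp (-L) ≤ p := by
      rw [Real.exp_neg, ← one_div]
      exact (one_div_le_one_div_of_le hw0 hHL).trans hpw
    exact h1.trans (Real.le_sqrt_of_sq_le (by nlinarith))
  set N := ⌈Real.exp (4 * d * L + 2 * L)⌉₊ with hN
  have hN1 : Real.exp (4 * d * L + 2 * L) ≤ N := Nat.le_ceil _
  have hN2 : (N : ℝ) + 1 ≤ Real.exp (4 * d * L + 3 * L) := by
    have h1 := (Nat.ceil_lt_add_one (Real.exp_pos (4 * d * L + 2 * L)).le).le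
    have h2 : Real.exp (4 * d * L + 3 * L) = Real.exp (4 * d * L + 2 * L) * Real.exp L := by
      rw [← Real.exp_add]
      congr 1
      ring
    have h3 : 1 ≤ Real.exp (4 * d * L + 2 * L) := Real.one_le_exp (by positivity)
    rw [h2]
    nlinarith
  have hN0 : 0 < N := Nat.ceil_pos.2 (Real.exp_pos _)
  have hbad := dropoutLaw_real_grid_le (S := S) (θ := θ) hd hK hp0 hp1 hw0 hHm
    (fun m => hcol (m + 1) (by omega) (by omega)) hL1 (by linarith) hN2
  have := isProbabilityMeasure_dropoutLaw d h hp0.le (by linarith : p ≤ 1)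
  set target := {w : Mask d h | ∀ t ∈ Set.Icc (0 : ℝ) 1,
      loss l S (onSegment θ (dropUpTo p w θ d) t) ≤
        loss l S θ + stabilityConstant K * (√p * ε * L)}
  set bad := {w : Mask d h | ∃ z ∈ S, ∃ k ≤ N,
      12 * d * L < ∑ m, layerNoise θ K p H ((k : ℝ) / N) z.1 m w}
  -- The good event has probability at least 1/2 and the bad grid event at most 1/4.
  suffices hsub : {w : Mask d h | SmoothFor S θ p ρ w ∧ SpreadFor S θ p K w} ⊆ target ∪ bad by
    have h1 := hgood.trans ((measureReal_mono hsub).trans (measureReal_union_le _ _))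
    linarith
  rintro w ⟨hsm, hspread⟩
  refine or_iff_not_imp_right.2 fun hnb => ?_
  simp only [bad, Set.mem_ofPred_eq, not_exists, not_and, not_lt] at hnb
  intro t ht
  refine loss_le_add hS fun z hz => ?_
  obtain ⟨k, hkN, hk, hkt⟩ := exists_grid_point hN0 ht
  set s : ℝ := (k : ℝ) / N
  have hμ0 := minCushion_pos (θ := θ) hd hS hout
  have hc0 := activationContraction_pos (θ := θ) hd hS hout
  have hzin : ‖z.1‖ ≤ Real.exp L := by
    have : ‖z.1‖ ≤ maxInput S := le_ciSup (f := fun z : S => ‖z.1.1‖) (Finite.bddAbove_range _) ⟨z, hz⟩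
    linarith
  have hzout : ‖output d θ z.1‖ ≤ maxOutput S θ :=
    le_ciSup (f := fun z : S => ‖output d θ z.1.1‖) (Finite.bddAbove_range _) ⟨z, hz⟩
  have hstep := mul_norm_output_sub_le (w := w) (θ := θ) (x := z.1) hd hβ hε hp0 hp1 hL1
    (by linarith) (fun i hi => by
      have h1 := hEw i hi
      have h2 : (0 : ℝ) ≤ h (i + 1) := by positivity
      linarith) hzin (by linarith) hsp hN1 ht hk hkt
  set M := 5 * K ^ 2 + 4 * K with hM
  have hM0 : 0 < M := by positivity
  set B := √p * ε * L / (β * maxOutput S θ) with hB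
  have hmax0 : 0 < maxOutput S θ := by
    obtain ⟨z, hz⟩ := hS
    exact (norm_pos_iff.2 (hout z hz)).trans_le
      (le_ciSup (f := fun z : S => ‖output d θ z.1.1‖) (Finite.bddAbove_range _) ⟨z, hz⟩)
  have hBK : B ≤ K := by
    rw [hB, div_le_iff₀ (by positivity)]
    exact hcond
  have hB0 : 0 ≤ B := by positivity
  have hA := cushion_mul_noiseScale_le (p := p) (L := L) hK (by omega) (by linarith) hβ hw0 hμ0 hc0
    hmax0
  rw [← hεeq, ← hB, ← hM] at hA
  have hs := norm_output_sub_le hd hS hout hK hp0 hw0 hρ hsm hspread hz hk (hnb z hz k hkN) hA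
  have hgrid := mul_le_of_relative_error (K := K) hβ hM0 hB0 hBK hzout hmax0.le
    (div_mul_cancel₀ _ (by positivity)) hs
  have hl' := (le_abs_self _).trans (hl z.2 (output d (onSegment θ (dropUpTo p w θ d) t) z.1)
    (output d θ z.1))
  have htri : ‖output d (onSegment θ (dropUpTo p w θ d) t) z.1 - output d θ z.1‖ ≤
      ‖output d (onSegment θ (dropUpTo p w θ d) t) z.1 -
        output d (onSegment θ (dropUpTo p w θ d) s) z.1‖ +
      ‖output d (onSegment θ (dropUpTo p w θ d) s) z.1 - output d θ z.1‖ :=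
    norm_sub_le_norm_sub_add_norm_sub _ _ _
  have htri' := mul_le_mul_of_nonneg_left htri hβ.le
  have hX : 0 ≤ √p * ε * L := by positivity
  -- The exponential summand of the constant covers the error at the grid point. One unit of the
  -- summand 16 covers the passage from the grid point to t.
  rw [stabilityConstant, ← hM]
  linarith

end ReluNet

/-! ### The main theorem -/

theorem lemma3 :
    ∃ k : ℕ, ∀ K : ℝ, 0 < K → ∃ C : ℝ, 0 < C ∧
      ∀ (d : ℕ) (h : ℕ → ℕ) (l : ReluNet.Vec (h d) → ReluNet.Vec (h d) → ℝ)
        (S : ReluNet.Sample d h) (θ : ReluNet.Params h) (β p ε : ℝ),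
        2 ≤ d → S.Nonempty →
        (∀ y a b, |l y a - l y b| ≤ β * ‖a - b‖) →
        ReluNet.IsNoiseStable S θ β p K (C * ReluNet.logFactor S θ β ε ^ k) ε →
        C * ReluNet.logFactor S θ β ε ^ k / (ReluNet.minWidth d h : ℝ) < p → p ≤ 3 / 4 →
        (∀ i, 1 ≤ i → i < d → ∀ j,
          ‖ReluNet.column (θ i) j‖ ≤ K * Real.sqrt p * ReluNet.frob (θ i)) →
        Real.sqrt p * ε * ReluNet.logFactor S θ β ε ^ k ≤ K * (β * ReluNet.maxOutput S θ) →
        (1 / 4 ≤ (ReluNet.dropoutLaw d h p).real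
            {w | ∀ t ∈ Set.Icc (0 : ℝ) 1,
              ReluNet.loss l S (ReluNet.onSegment θ (ReluNet.dropUpTo p w θ d) t) ≤
                ReluNet.loss l S θ +
                  C * (Real.sqrt p * ε * ReluNet.logFactor S θ β ε ^ k)}) ∧
        (p = 3 / 4 → ReluNet.IsDropoutStable l S θ
          (C * (Real.sqrt p * ε * ReluNet.logFactor S θ β ε ^ k))) := by
  refine ⟨1, fun K hK => ⟨ReluNet.stabilityConstant K, by
    unfold ReluNet.stabilityConstant; positivity, ?_⟩⟩
  intro d h l S θ β p ε hd hS hl hstable hp hp1 hcol hcond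
  obtain ⟨hout, hεeq, hwidth, ρ, hρ, hgood⟩ := hstable
  simp only [pow_one] at *
  -- The value 16 makes the width at least 16L, as the Chernoff bound on kept units requires.
  have hC : 16 ≤ ReluNet.stabilityConstant K := by
    unfold ReluNet.stabilityConstant
    have : 0 ≤ 24 * (5 * K ^ 2 + 4 * K) * Real.exp (24 * (5 * K ^ 2 + 4 * K) * K + 1) := by
      positivity
    linarith
  have hμ0 := ReluNet.minCushion_pos (θ := θ) hd hS hout
  have hc0 := ReluNet.activationContraction_pos (θ := θ) hd hS hout
  obtain ⟨z, hz⟩ := id hS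
  have hz0 := norm_pos_iff.2 (hout z hz)
  have hmax0 : 0 < ReluNet.maxOutput S θ := hz0.trans_le
    (le_ciSup (f := fun z : S => ‖ReluNet.output d θ z.1.1‖) (Finite.bddAbove_range _) ⟨z, hz⟩)
  -- The Lipschitz inequality tested at 0 and a nonzero output forces the sign of β.
  have hβ : 0 ≤ β := by
    have := (abs_nonneg _).trans (hl 0 (ReluNet.output d θ z.1) 0)
    rw [sub_zero] at this
    exact nonneg_of_mul_nonneg_left this hz0
  have hε : 0 ≤ ε := by
    rw [hεeq, ReluNet.noiseParameter]
    positivity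
  have hβε : 0 ≤ β / ε := by positivity
  have hL1 := ReluNet.one_le_logFactor S θ hβε
  have hE := ReluNet.add_le_exp_logFactor S θ hβε
  set L := ReluNet.logFactor S θ β ε with hL
  have hCL : 16 * L ≤ ReluNet.stabilityConstant K * L := by gcongr
  have hw0 : 0 < (ReluNet.minWidth d h : ℝ) := by linarith
  have hpw : 1 / (ReluNet.minWidth d h : ℝ) ≤ p := by
    refine le_trans ?_ hp.le
    gcongr
    linarith
  have hp0 : 0 < p := lt_of_lt_of_le (by positivity) hpw
  have hprob : 1 / 4 ≤ (ReluNet.dropoutLaw d h p).real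
      {w | ∀ t ∈ Set.Icc (0 : ℝ) 1,
        ReluNet.loss l S (ReluNet.onSegment θ (ReluNet.dropUpTo p w θ d) t) ≤
          ReluNet.loss l S θ + ReluNet.stabilityConstant K * (√p * ε * L)} := by
    -- For β = 0 also ε = 0, and the quotient β/ε carries no information. But then the loss does not
    -- depend on the network.
    rcases hβ.eq_or_lt' with hβ0 | hβ0
    · have := ReluNet.isProbabilityMeasure_dropoutLaw d h hp0.le (by linarith : p ≤ 1)
      have huniv : {w : ReluNet.Mask d h | ∀ t ∈ Set.Icc (0 : ℝ) 1,
          ReluNet.loss l S (ReluNet.onSegment θ (ReluNet.dropUpTo p w θ d) t) ≤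
            ReluNet.loss l S θ + ReluNet.stabilityConstant K * (√p * ε * L)} = Set.univ := by
        refine Set.eq_univ_of_forall fun w t _ => ReluNet.loss_le_add hS fun z _ => ?_
        have h1 := (le_abs_self _).trans (hl z.2
          (ReluNet.output d (ReluNet.onSegment θ (ReluNet.dropUpTo p w θ d) t) z.1)
          (ReluNet.output d θ z.1))
        have h2 : 0 ≤ ReluNet.stabilityConstant K * (√p * ε * L) := by positivity
        rw [hβ0, zero_mul] at h1
        linarith
      rw [huniv, probReal_univ]
      norm_num
    · have hd0 : (0 : ℝ) < d := by exact_mod_cast (by omega : 0 < d)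
      have hε0 : 0 < ε := by
        rw [hεeq, ReluNet.noiseParameter]
        have := Real.sqrt_pos.2 hw0
        positivity
      exact ReluNet.prob_loss_le hK hd hS hβ0 hε0 hl hout hεeq hL hρ hgood hw0 hpw hp1 hcol hcond
  refine ⟨hprob, ?_⟩
  rintro rfl
  have hin0 := ReluNet.maxInput_nonneg S
  have hcard0 : (0 : ℝ) ≤ S.card := by positivity
  have := ReluNet.isProbabilityMeasure_dropoutLaw d h (p := 3 / 4) (by norm_num) (by norm_num)
  refine ReluNet.isDropoutStable_of_prob (L := L) (by linarith) (hCL.trans hwidth)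
    (hprob.trans (measureReal_mono fun w hw => ?_))
  -- The endpoint t = 1 is the fully dropped-out network, to which the count of kept units applies.
  have := hw 1 (by simp)
  have hone : ReluNet.onSegment θ (ReluNet.dropUpTo (3 / 4) w θ d) 1 =
      ReluNet.dropUpTo (3 / 4) w θ d := by
    simp [ReluNet.onSegment]
  rw [hone] at this
  exact this
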